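/- Work in the simply typed $\lambda$-calculus over arbitrary base types, constants and an infinite supply of free variables of every type; terms are considered modulo $\alpha\beta\eta$, with the $\eta$-long $\beta$-reduced form as canonical representative. A term is ground if it contains no free variables (bound variables without an enclosing binder are allowed). A term is solid if every argument of each of its free variables is either a bound variable or a ground term of base type. A unifier of $s \overset{?}{=} t$ is a substitution $\sigma$ (of terms for free variables) with $\sigma s = \sigma t$. A set $U$ of unifiers together with a set $V$ of auxiliary free variables, none of which occurs in $s$ or $t$, is a complete set of unifiers (CSU) if for every unifier $\varrho$ there are $\sigma\in U$ and a substitution $\theta$ with $\varrho X=\theta\sigma X$ for all free variables $X\notin V$. A most general unifier (MGU) is a one-element CSU. (1) Different heads. Let $\lambda\overline{x}.\,F\,s_1\dots s_m$ and $\lambda\overline{x}.\,F'\,s'_1\dots s'_{m'}$ be solid terms of the same type with free variables $F\neq F'$ and bodies of base type. For all $1 \le i\le m$ and every free variable $H_i$ of suitable type, the problem $\lambda\overline{x}.\,s_i \overset{?}{=} \lambda\overline{x}.\,H_i\,s'_1\dots s'_{m'}$ has a finite CSU $\{\sigma_i^1,\dots,\sigma_i^{k_i}\}$ whose auxiliary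 variables differ from $F$ and $F'$. Likewise, for all $1 \le i\le m'$ and every $\tilde H_i$, the problem $\lambda\overline{x}.\,s'_i \overset{?}{=} \lambda\overline{x}.\,\tilde H_i\,s_1\dots s_m$ has such a finite CSU $\{\tilde\sigma_i^1,\dots,\tilde\sigma_i^{l_i}\}$. Choose all $H_i$, $\tilde H_i$, such finite CSUs, and a free variable $Z$ of suitable type, in any way such that $F$ and $F'$ are not among $Z$, the $H_i$, the $\tilde H_i$ and the auxiliary variables of the CSUs; such choices exist. Let $s_i^j=\sigma_i^j(H_i)\,y_1\dots y_{m'}$ and ${s'}_i^j=\tilde\sigma_i^j(\tilde H_i)\,x_1\dots x_m$. Then the substitution that maps $$F\mapsto\lambda x_1\dots x_m.\;Z\;\underbrace{x_1\dots x_1}_{k_1}\dots\underbrace{x_m\dots x_m}_{k_m}\;{s'}_1^1\dots{s'}_1^{l_1}\dots{s'}_{m'}^1\dots{s'}_{m'}^{l_{m'}},$$ $$F'\mapsto\lambda y_1\dots y_{m'}.\;Z\;s_1^1\dots s_1^{k_1}\dots s_m^1\dots s_m^{k_m}\;\underbrace{y_1\dots y_1}_{l_1}\dots\underbrace{y_{m'}\dots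 y_{m'}}_{l_{m'}},$$ and every other free variable to itself, is an MGU of $\lambda\overline{x}.\,F\,s_1\dots s_m\overset{?}{=}\lambda\overline{x}.\,F'\,s'_1\dots s'_{m'}$, where the auxiliary variables are $Z$, the $H_i$, the $\tilde H_i$ and all auxiliary variables of the chosen CSUs. (2) Equal heads. Let $\lambda\overline{z}.\,F\,s_1\dots s_m$ and $\lambda\overline{z}.\,F\,s'_1\dots s'_m$ be solid terms with bodies of base type, and let $1\le j_1<\dots<j_r\le m$ be exactly the indices $j$ with $s_j=s'_j$. Then there is a free variable $G\neq F$ of suitable type, and for every such $G$ the substitution $\{F\mapsto\lambda x_1\dots x_m.\,G\,x_{j_1}\dots x_{j_r}\}$ is an MGU of $\lambda\overline{z}.\,F\,s_1\dots s_m\overset{?}{=}\lambda\overline{z}.\,F\,s'_1\dots s'_m$ with the single auxiliary variable $G$. -/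

import Mathlib

namespace HOU

universe u v w

/-- Simple types over a set `B` of base types. -/
inductive Ty (B : Type u) : Type u
  | base : B → Ty B
  | arr : Ty B → Ty B → Ty B

/-- A list of types, *read from right to left*: the list `[α_m, …, α_1]` lists the types of bound
variables `x_1, …, x_m`, the most recently bound one first. -/
abbrev Ctx (B : Type u) : Type u := List (Ty B)

/-- `arrows [α_m, …, α_1] β` is the type `α_1 → ⋯ → α_m → β`. -/
def arrows {B : Type u} : Ctx B → Ty B → Ty B
  | [], β => β
  | α :: αs, β => arrows αs (Ty.arr α β)

/-- `Var Γ α` is the set of positions of `Γ` that hold the type `α`. These are the typed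
de Bruijn indices; they also serve to enumerate the arguments of a head symbol. -/
inductive Var {B : Type u} : Ctx B → Ty B → Type u
  | zero {Γ : Ctx B} {α : Ty B} : Var (α :: Γ) α
  | succ {Γ : Ctx B} {α β : Ty B} : Var Γ α → Var (β :: Γ) α

/-- Simply typed terms of type `τ` whose loose bound variables are listed in `Γ`. `FV τ` and `C τ`
are the sets of free variables and of constants of type `τ`. Terms are identified up to
`α`-renaming, because bound variables are de Bruijn indices. -/
inductive Tm {B : Type u} (FV : Ty B → Type v) (C : Ty B → Type w) :
    Ctx B → Ty B → Type (max u v w)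
  | fvar {Γ : Ctx B} {τ : Ty B} : FV τ → Tm FV C Γ τ
  | const {Γ : Ctx B} {τ : Ty B} : C τ → Tm FV C Γ τ
  | bvar {Γ : Ctx B} {τ : Ty B} : Var Γ τ → Tm FV C Γ τ
  | app {Γ : Ctx B} {α β : Ty B} : Tm FV C Γ (Ty.arr α β) → Tm FV C Γ α → Tm FV C Γ β
  | lam {Γ : Ctx B} {α β : Ty B} : Tm FV C (α :: Γ) β → Tm FV C Γ (Ty.arr α β)

/-- A free variable together with its type. -/
abbrev FVar {B : Type u} (FV : Ty B → Type v) : Type (max u v) := Σ τ : Ty B, FV τ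

/-- The bundled version of a free variable. -/
abbrev fv {B : Type u} {FV : Ty B → Type v} {τ : Ty B} (X : FV τ) : FVar FV := ⟨τ, X⟩

section

variable {B : Type u} {FV : Ty B → Type v} {C : Ty B → Type w}

/-! ### Renaming and substitution of bound variables -/

/-- Renamings of bound variables. -/
def Ren (Γ Δ : Ctx B) : Type u := ∀ α : Ty B, Var Γ α → Var Δ α

/-- Extend a renaming under a binder. -/
def Ren.lift {Γ Δ : Ctx B} (r : Ren Γ Δ) (β : Ty B) : Ren (β :: Γ) (β :: Δ)
  | _, .zero => .zero
  | _, .succ x => .succ (r _ x)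

/-- Apply a renaming. -/
def Tm.rename {Γ Δ : Ctx B} {τ : Ty B} (r : Ren Γ Δ) : Tm FV C Γ τ → Tm FV C Δ τ
  | .fvar F => .fvar F
  | .const c => .const c
  | .bvar x => .bvar (r _ x)
  | .app s t => .app (s.rename r) (t.rename r)
  | .lam t => .lam (t.rename (r.lift _))

/-- Weakening by one new bound variable. -/
def Tm.wk {Γ : Ctx B} {τ : Ty B} (β : Ty B) (t : Tm FV C Γ τ) : Tm FV C (β :: Γ) τ :=
  t.rename fun _ x => .succ x

/-- Families of terms over `Γ`, one for each position of `Δ`, of the type found there.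
They are used as simultaneous substitutions for bound variables and as tuples of arguments
`s_1, …, s_m`. -/
def Args (FV : Ty B → Type v) (C : Ty B → Type w) (Δ Γ : Ctx B) : Type (max u v w) :=
  ∀ α : Ty B, Var Δ α → Tm FV C Γ α

/-- The empty tuple of arguments. -/
def Args.nil {Γ : Ctx B} : Args FV C [] Γ := fun _ x => nomatch x

/-- Append one argument at the end of a tuple. -/
def Args.snoc {Δ Γ : Ctx B} {α : Ty B} (s : Args FV C Δ Γ) (t : Tm FV C Γ α) :
    Args FV C (α :: Δ) Γ
  | _, .zero => t
  | _, .succ x => s _ x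

/-- Concatenation: first the arguments `s`, and then the arguments `t`. -/
def Args.append {Δ Γ : Ctx B} (s : Args FV C Δ Γ) :
    (Δ' : Ctx B) → Args FV C Δ' Γ → Args FV C (Δ' ++ Δ) Γ
  | [], _ => s
  | _ :: Δ', t => (s.append Δ' fun _ x => t _ (.succ x)).snoc (t _ .zero)

/-- Extend a substitution for bound variables under a binder. -/
def Args.lift {Γ Δ : Ctx B} (s : Args FV C Γ Δ) (β : Ty B) : Args FV C (β :: Γ) (β :: Δ) :=
  Args.snoc (fun _ x => (s _ x).wk β) (.bvar .zero)

/-- Capture-avoiding simultaneous substitution of terms for bound variables. -/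
def Tm.subst {Γ Δ : Ctx B} {τ : Ty B} (s : Args FV C Γ Δ) : Tm FV C Γ τ → Tm FV C Δ τ
  | .fvar F => .fvar F
  | .const c => .const c
  | .bvar x => s _ x
  | .app t t' => .app (t.subst s) (t'.subst s)
  | .lam t => .lam (t.subst (s.lift _))

/-- Replace the most recently bound variable of `t` by `a`. -/
def Tm.inst {Γ : Ctx B} {α β : Ty B} (t : Tm FV C (α :: Γ) β) (a : Tm FV C Γ α) : Tm FV C Γ β :=
  t.subst (Args.snoc (fun _ x => .bvar x) a)

/-! ### Equality of terms -/

/-- `αβη`-equivalence. -/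
inductive Conv : ∀ {Γ : Ctx B} {τ : Ty B}, Tm FV C Γ τ → Tm FV C Γ τ → Prop
  | refl {Γ : Ctx B} {τ : Ty B} (t : Tm FV C Γ τ) : Conv t t
  | symm {Γ : Ctx B} {τ : Ty B} {s t : Tm FV C Γ τ} : Conv s t → Conv t s
  | trans {Γ : Ctx B} {τ : Ty B} {s t r : Tm FV C Γ τ} : Conv s t → Conv t r → Conv s r
  | app {Γ : Ctx B} {α β : Ty B} {s s' : Tm FV C Γ (Ty.arr α β)} {t t' : Tm FV C Γ α} :
      Conv s s' → Conv t t' → Conv (Tm.app s t) (Tm.app s' t')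
  | lam {Γ : Ctx B} {α β : Ty B} {t t' : Tm FV C (α :: Γ) β} :
      Conv t t' → Conv (Tm.lam t) (Tm.lam t')
  | beta {Γ : Ctx B} {α β : Ty B} (t : Tm FV C (α :: Γ) β) (a : Tm FV C Γ α) :
      Conv (Tm.app (Tm.lam t) a) (t.inst a)
  | eta {Γ : Ctx B} {α β : Ty B} (t : Tm FV C Γ (Ty.arr α β)) :
      Conv (Tm.lam (Tm.app (t.wk α) (Tm.bvar .zero))) t

mutual

/-- A head symbol applied to `η`-long `β`-reduced arguments. -/
inductive Neutral : ∀ {Γ : Ctx B} {τ : Ty B}, Tm FV C Γ τ → Prop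
  | fvar {Γ : Ctx B} {τ : Ty B} (F : FV τ) : Neutral (Tm.fvar F : Tm FV C Γ τ)
  | const {Γ : Ctx B} {τ : Ty B} (c : C τ) : Neutral (Tm.const c : Tm FV C Γ τ)
  | bvar {Γ : Ctx B} {τ : Ty B} (x : Var Γ τ) : Neutral (Tm.bvar x : Tm FV C Γ τ)
  | app {Γ : Ctx B} {α β : Ty B} {s : Tm FV C Γ (Ty.arr α β)} {t : Tm FV C Γ α} :
      Neutral s → LongNormal t → Neutral (Tm.app s t)

/-- `η`-long `β`-reduced terms, the canonical representatives of the `αβη`-classes. -/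
inductive LongNormal : ∀ {Γ : Ctx B} {τ : Ty B}, Tm FV C Γ τ → Prop
  | lam {Γ : Ctx B} {α β : Ty B} {t : Tm FV C (α :: Γ) β} : LongNormal t → LongNormal (Tm.lam t)
  | base {Γ : Ctx B} {b : B} {t : Tm FV C Γ (Ty.base b)} : Neutral t → LongNormal t

end

/-! ### Free variables and solid terms -/

/-- The free variable `X` occurs in a term. -/
def Tm.Occurs (X : FVar FV) : ∀ {Γ : Ctx B} {τ : Ty B}, Tm FV C Γ τ → Prop
  | _, _, .fvar F => X = fv F
  | _, _, .const _ => False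
  | _, _, .bvar _ => False
  | _, _, .app s t => s.Occurs X ∨ t.Occurs X
  | _, _, .lam t => t.Occurs X

/-- A term is ground if it has no free variables. (It may have loose bound variables.) -/
def Tm.Ground {Γ : Ctx B} {τ : Ty B} (t : Tm FV C Γ τ) : Prop := ∀ X : FVar FV, ¬ t.Occurs X

/-- The term is a free variable applied to zero or more arguments. -/
def Tm.Flex : ∀ {Γ : Ctx B} {τ : Ty B}, Tm FV C Γ τ → Prop
  | _, _, .fvar _ => True
  | _, _, .app s _ => s.Flex
  | _, _, .const _ => False
  | _, _, .bvar _ => False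
  | _, _, .lam _ => False

/-- The terms allowed as arguments of a free variable in a solid term: bound variables (of any
type) and ground terms of base type. -/
def Tm.SolidArg {Γ : Ctx B} {α : Ty B} (t : Tm FV C Γ α) : Prop :=
  (∃ x : Var Γ α, Conv t (.bvar x)) ∨ ((∃ b : B, α = Ty.base b) ∧ t.Ground)

/-- All arguments of free variables, anywhere in the term, are bound variables or ground terms of
base type. -/
def Tm.FlexArgsSolid : ∀ {Γ : Ctx B} {τ : Ty B}, Tm FV C Γ τ → Prop
  | _, _, .app s t => s.FlexArgsSolid ∧ t.FlexArgsSolid ∧ (s.Flex → t.SolidArg)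
  | _, _, .lam t => t.FlexArgsSolid
  | _, _, .fvar _ => True
  | _, _, .const _ => True
  | _, _, .bvar _ => True

/-- Solid terms, given by their `η`-long `β`-reduced representatives. -/
def Tm.Solid {Γ : Ctx B} {τ : Ty B} (t : Tm FV C Γ τ) : Prop := LongNormal t ∧ t.FlexArgsSolid

/-! ### Iterated abstraction and application -/

/-- `lams [α_m, …, α_1] t` is `λ x_1 … x_m. t`. -/
def lams {Γ : Ctx B} : (Δ : Ctx B) → {τ : Ty B} → Tm FV C (Δ ++ Γ) τ → Tm FV C Γ (arrows Δ τ)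
  | [], _, t => t
  | _ :: Δ, _, t => lams Δ (.lam t)

/-- `apps Δ t s` is `t s_1 … s_m`. -/
def apps {Γ : Ctx B} :
    (Δ : Ctx B) → {τ : Ty B} → Tm FV C Γ (arrows Δ τ) → Args FV C Δ Γ → Tm FV C Γ τ
  | [], _, t, _ => t
  | _ :: Δ, _, t, s => .app (apps Δ t fun _ x => s _ (.succ x)) (s _ .zero)

/-- A position of `Δ` as a position of `Δ ++ Γ`. -/
def Var.inl {Γ : Ctx B} {α : Ty B} : {Δ : Ctx B} → Var Δ α → Var (Δ ++ Γ) α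
  | _, .zero => .zero
  | _, .succ x => .succ x.inl

/-- A position of `Γ` as a position of `Δ ++ Γ`. -/
def Var.inr {Γ : Ctx B} {α : Ty B} : (Δ : Ctx B) → Var Γ α → Var (Δ ++ Γ) α
  | [], x => x
  | _ :: Δ, x => .succ (x.inr Δ)

/-- Weakening by several new bound variables. -/
def Tm.wks {Γ : Ctx B} {τ : Ty B} (Δ : Ctx B) (t : Tm FV C Γ τ) : Tm FV C (Δ ++ Γ) τ :=
  t.rename fun _ x => x.inr Δ

/-- The bound variables `x_1, …, x_m` themselves as a tuple of arguments. -/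
def boundVars (FV : Ty B → Type v) (C : Ty B → Type w) (Γ Δ : Ctx B) : Args FV C Δ (Δ ++ Γ) :=
  fun _ x => .bvar x.inl

/-! ### Substitutions for free variables, unifiers -/

/-- Substitutions for free variables, by terms whose loose bound variables are listed in `Γ`. -/
def FSubst (FV : Ty B → Type v) (C : Ty B → Type w) (Γ : Ctx B) : Type (max u v w) :=
  (X : FVar FV) → Tm FV C Γ X.1

/-- Apply a substitution to a term; loose bound variables of the substituted terms are never
captured. -/
def Tm.fsubst : ∀ {Γ : Ctx B} {τ : Ty B}, FSubst FV C Γ → Tm FV C Γ τ → Tm FV C Γ τ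
  | _, _, σ, .fvar F => σ (fv F)
  | _, _, _, .const c => .const c
  | _, _, _, .bvar x => .bvar x
  | _, _, σ, .app s t => .app (s.fsubst σ) (t.fsubst σ)
  | _, _, σ, .lam t => .lam (t.fsubst fun X => (σ X).wk _)

/-- The identity substitution. -/
def FSubst.id (FV : Ty B → Type v) (C : Ty B → Type w) (Γ : Ctx B) : FSubst FV C Γ :=
  fun X => .fvar X.2

open Classical in
/-- `σ.bind F t` maps `F` to `t` and otherwise coincides with `σ`. -/
noncomputable def FSubst.bind {Γ : Ctx B} (σ : FSubst FV C Γ) {τ : Ty B} (F : FV τ)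
    (t : Tm FV C Γ τ) : FSubst FV C Γ :=
  Function.update σ (fv F) t

/-- `σ` is a unifier of the constraint `s ≟ t`. -/
def IsUnifier {Γ : Ctx B} {τ : Ty B} (s t : Tm FV C Γ τ) (σ : FSubst FV C Γ) : Prop :=
  Conv (s.fsubst σ) (t.fsubst σ)

/-- `U` is a complete set of unifiers of the constraint `s ≟ t` with auxiliary variables `V`. -/
def IsCSU {Γ : Ctx B} {τ : Ty B} (s t : Tm FV C Γ τ) (U : Set (FSubst FV C Γ))
    (V : Set (FVar FV)) : Prop :=
  (∀ σ ∈ U, IsUnifier s t σ) ∧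
  (∀ X ∈ V, ¬ s.Occurs X ∧ ¬ t.Occurs X) ∧
  ∀ ρ : FSubst FV C Γ, IsUnifier s t ρ →
    ∃ σ ∈ U, ∃ θ : FSubst FV C Γ, ∀ X ∉ V, Conv (ρ X) ((σ X).fsubst θ)

/-- `σ` is a most general unifier of the constraint `s ≟ t` with auxiliary variables `V`. -/
def IsMGU {Γ : Ctx B} {τ : Ty B} (s t : Tm FV C Γ τ) (σ : FSubst FV C Γ)
    (V : Set (FVar FV)) : Prop :=
  IsCSU s t {σ} V

/-! ### Tuples in which the `i`-th entry is replaced by a block of `k i` entries -/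

/-- The types `α_1, …, α_1, …, α_m, …, α_m` with `α_i` repeated `k i` times. -/
def blockTypes : (αs : Ctx B) → (∀ α, Var αs α → ℕ) → Ctx B
  | [], _ => []
  | α :: αs, k => List.replicate (k α .zero) α ++ blockTypes αs fun _ i => k _ (.succ i)

/-- The tuple `a 0, …, a (n - 1)` of terms of one type `α`. -/
def blockArgs {Γ : Ctx B} {α : Ty B} :
    (n : ℕ) → (Fin n → Tm FV C Γ α) → Args FV C (List.replicate n α) Γ
  | 0, _ => Args.nil
  | n + 1, a => (blockArgs n fun j => a j.castSucc).snoc (a (Fin.last n))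

/-- The tuple `a_1^1, …, a_1^{k_1}, …, a_m^1, …, a_m^{k_m}`. -/
def blocksArgs {Γ : Ctx B} :
    (αs : Ctx B) → (k : ∀ α, Var αs α → ℕ) → (∀ α (i : Var αs α), Fin (k α i) → Tm FV C Γ α) →
      Args FV C (blockTypes αs k) Γ
  | [], _, _ => Args.nil
  | α :: αs, k, a =>
    (blocksArgs αs (fun _ i => k _ (.succ i)) fun _ i => a _ (.succ i)).append
      (List.replicate (k α .zero) α) (blockArgs (k α .zero) (a α .zero))

/-! ### Flex-flex constraints -/

/-- The term `λ x̄. F s_1 … s_m`, where `x̄` is listed in `Δ`. -/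
def flexTerm {Γ : Ctx B} (Δ : Ctx B) {αs : Ctx B} {β : Ty B} (F : FV (arrows αs β))
    (s : Args FV C αs (Δ ++ Γ)) : Tm FV C Γ (arrows Δ β) :=
  lams Δ (apps αs (.fvar F) s)

/-- A choice, for every position `i` of the tuple `s`, of a variable `H i` and of a finite complete
set of unifiers `csu i 0, …, csu i (num i - 1)`, with auxiliary variables `aux i`, of the constraint
`λ x̄. s_i ≟ λ x̄. H_i s'_1 … s'_{m'}`. -/
structure MatchingCSUs (Γ Δ : Ctx B) {αs αs' : Ctx B} (s : Args FV C αs (Δ ++ Γ))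
    (s' : Args FV C αs' (Δ ++ Γ)) where
  H : ∀ α, Var αs α → FV (arrows αs' α)
  num : ∀ α, Var αs α → ℕ
  csu : ∀ α (i : Var αs α), Fin (num α i) → FSubst FV C Γ
  aux : ∀ α, Var αs α → Set (FVar FV)
  isCSU : ∀ α (i : Var αs α),
    IsCSU (lams Δ (s α i)) (flexTerm Δ (H α i) s') (Set.range (csu α i)) (aux α i)

/-- All the variables `H i` and all the auxiliary variables of the complete sets of unifiers. -/
def MatchingCSUs.vars {Γ Δ αs αs' : Ctx B} {s : Args FV C αs (Δ ++ Γ)}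
    {s' : Args FV C αs' (Δ ++ Γ)} (M : MatchingCSUs Γ Δ s s') : Set (FVar FV) :=
  {X | ∃ α, ∃ i : Var αs α, X = fv (M.H α i) ∨ X ∈ M.aux α i}

/-- The term `s_i^j`, that is, the body `σ_i^j(H_i) y_1 … y_{m'}` of the value of `H_i`
under the `j`-th unifier. -/
def MatchingCSUs.sol {Γ Δ αs αs' : Ctx B} {s : Args FV C αs (Δ ++ Γ)}
    {s' : Args FV C αs' (Δ ++ Γ)} (M : MatchingCSUs Γ Δ s s') (α : Ty B) (i : Var αs α)
    (j : Fin (M.num α i)) : Tm FV C (αs' ++ Γ) α :=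
  apps αs' ((M.csu α i j (fv (M.H α i))).wks αs') (boundVars FV C Γ αs')

/-- The types of the arguments of the common fresh head `Z`: the type of `s_i` is repeated as often
as there are matchers for `s_i`, and then the same for the `s'_i`. -/
def commonTypes {Γ Δ αs αs' : Ctx B} {s : Args FV C αs (Δ ++ Γ)} {s' : Args FV C αs' (Δ ++ Γ)}
    (M : MatchingCSUs Γ Δ s s') (M' : MatchingCSUs Γ Δ s' s) : Ctx B :=
  blockTypes αs' M'.num ++ blockTypes αs M.num

/-- The substitution
`F  ↦ λ x_1 … x_m.     Z x_1 … x_1 … x_m … x_m  s'_1^1 … s'_1^{l_1} … s'_{m'}^1 … s'_{m'}^{l_{m'}}`,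
`F' ↦ λ y_1 … y_{m'}.  Z s_1^1 … s_1^{k_1} … s_m^1 … s_m^{k_m}  y_1 … y_1 … y_{m'} … y_{m'}`,
with `x_i` repeated `k_i` times and `y_i` repeated `l_i` times. -/
noncomputable def commonHeadSubst {Γ Δ αs αs' : Ctx B} {β : Ty B} (F : FV (arrows αs β))
    (F' : FV (arrows αs' β)) {s : Args FV C αs (Δ ++ Γ)} {s' : Args FV C αs' (Δ ++ Γ)}
    (M : MatchingCSUs Γ Δ s s') (M' : MatchingCSUs Γ Δ s' s)
    (Z : FV (arrows (commonTypes M M') β)) : FSubst FV C Γ :=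
  ((FSubst.id FV C Γ).bind F
    (lams αs (apps (commonTypes M M') (.fvar Z)
      ((blocksArgs αs M.num fun α i _ => boundVars FV C Γ αs α i).append
        (blockTypes αs' M'.num) (blocksArgs αs' M'.num M'.sol))))).bind F'
    (lams αs' (apps (commonTypes M M') (.fvar Z)
      ((blocksArgs αs M.num M.sol).append
        (blockTypes αs' M'.num)
        (blocksArgs αs' M'.num fun α i _ => boundVars FV C Γ αs' α i))))

open Classical in
/-- The number `1` at the positions where `s` and `s'` agree, and `0` at the other ones. -/
noncomputable def agree {Γ αs : Ctx B} (s s' : Args FV C αs Γ) (α : Ty B) (i : Var αs α) : ℕ :=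
  if Conv (s α i) (s' α i) then 1 else 0

/-- The substitution `F ↦ λ x_1 … x_m. G x_{j_1} … x_{j_r}`, where `j_1 < ⋯ < j_r` are
the positions at which `s` and `s'` agree. -/
noncomputable def eliminationSubst {Γ Δ αs : Ctx B} {β : Ty B} (F : FV (arrows αs β))
    (s s' : Args FV C αs (Δ ++ Γ)) (G : FV (arrows (blockTypes αs (agree s s')) β)) :
    FSubst FV C Γ :=
  (FSubst.id FV C Γ).bind F
    (lams αs (apps (blockTypes αs (agree s s')) (.fvar G)
      (blocksArgs αs (agree s s') fun α i _ => boundVars FV C Γ αs α i)))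

end

end HOU

open HOU

/-!
The proof works with the values of free variables under an arbitrary unifier `ρ`. Let `t` and `t'`
be the long normal forms of the bodies of `ρ F` and `ρ F'`. The arguments `s_i` and `s'_i` are
ground, so that `ρ` unifies the two flexible terms if and only if `t[s]` and `t'[s']` are
convertible. Every argument of a solid term is convertible to a neutral term: a bound variable, or
a term of base type. Substituting neutral terms creates no redexes, and hence `t[s]` and `t'[s']`,
computed with the neutral representatives, are equal as syntactic objects. From here on the
argument is first-order.

* For equal heads, `t[s] = t[s']` forces every variable of `t` to be one on which `s` and `s'`
  agree (`Tm.exists_rename_of_subst_eq`), and the elimination substitution keeps exactly those.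
* For different heads, `exists_common_generalization` descends simultaneously through `t` and `t'`.
  Where it meets a variable `x_i` in `t`, the corresponding subterm `v` of `t'` solves the matching
  problem `v[s'] = s_i`, and so it is one of the `s_i^j`: the pair `(x_i, s_i^j)` is an argument of
  `Z`. The variables bound inside `t` and `t'` do not get into `v`, by strengthening
  (`Tm.exists_wk_of_subst_lift_eq`). The common generalization is the body of the value of `Z`.
* A matching problem has finitely many solutions, because they arise from `s_i` by putting
  variables in the place of subterms (`Tm.finite_matchers`). All of them are ground, and so every
  complete set of unifiers has to contain each of them, whatever its auxiliary variables are
  (`MatchingCSUs.exists_conv_sol`).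

Two facts about the `λ`-calculus are needed: long normal forms exist (`exists_longNormal`, by Tait's
method) and are unique (`LongNormal.eq_of_den_eq`). Uniqueness is proved without confluence, by
evaluation in a full type hierarchy over terms with de Bruijn levels, from which a long normal form
can be read off. Together they show that convertibility is equality in this model
(`conv_iff_den`); all `βη`-computations with iterated abstractions, applications and
substitutions for free variables are done there.
-/

namespace HOU

universe u v w

section

variable {B : Type u} {FV : Ty B → Type v} {C : Ty B → Type w}

/-! ### Composition of renamings and substitutions -/

/-- Weakening by one new bound variable, as a renaming. -/
def Ren.shift {Γ : Ctx B} (β : Ty B) : Ren Γ (β :: Γ) := fun _ x => .succ x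

/-- The identity renaming. -/
def Ren.id {Γ : Ctx B} : Ren Γ Γ := fun _ x => x

/-- Composition of renamings, in diagrammatic order. -/
def Ren.comp {Γ Δ Θ : Ctx B} (r : Ren Γ Δ) (r' : Ren Δ Θ) : Ren Γ Θ := fun _ x => r' _ (r _ x)

/-- The identity substitution for bound variables. -/
def Args.id {Γ : Ctx B} : Args FV C Γ Γ := fun _ x => .bvar x

/-- A renaming followed by a substitution. -/
def Args.precomp {Γ Δ Θ : Ctx B} (r : Ren Γ Δ) (s : Args FV C Δ Θ) : Args FV C Γ Θ :=
  fun _ x => s _ (r _ x)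

/-- A substitution followed by a renaming. -/
def Args.rename {Γ Δ Θ : Ctx B} (s : Args FV C Γ Δ) (r : Ren Δ Θ) : Args FV C Γ Θ :=
  fun _ x => (s _ x).rename r

/-- Composition of substitutions, in diagrammatic order. -/
def Args.comp {Γ Δ Θ : Ctx B} (s : Args FV C Γ Δ) (s' : Args FV C Δ Θ) : Args FV C Γ Θ :=
  fun _ x => (s _ x).subst s'

theorem Tm.wk_eq_rename {Γ : Ctx B} {τ : Ty B} (t : Tm FV C Γ τ) (β : Ty B) :
    t.wk β = t.rename (Ren.shift β) := rfl

theorem Ren.lift_comp {Γ Δ Θ : Ctx B} (r : Ren Γ Δ) (r' : Ren Δ Θ) (β : Ty B) :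
    (r.lift β).comp (r'.lift β) = (r.comp r').lift β := by
  funext α x
  cases x <;> rfl

theorem Tm.rename_rename {Γ Δ Θ : Ctx B} {τ : Ty B} (t : Tm FV C Γ τ) (r : Ren Γ Δ)
    (r' : Ren Δ Θ) : (t.rename r).rename r' = t.rename (r.comp r') := by
  induction t generalizing Δ Θ with
  | fvar | const | bvar => rfl
  | app s t ihs iht => simp only [Tm.rename, ihs, iht]
  | lam t ih => simp only [Tm.rename, ih, Ren.lift_comp]

theorem Args.precomp_lift {Γ Δ Θ : Ctx B} (r : Ren Γ Δ) (s : Args FV C Δ Θ) (β : Ty B) :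
    (s.lift β).precomp (r.lift β) = (s.precomp r).lift β := by
  funext α x
  cases x <;> rfl

theorem Tm.subst_rename {Γ Δ Θ : Ctx B} {τ : Ty B} (t : Tm FV C Γ τ) (r : Ren Γ Δ)
    (s : Args FV C Δ Θ) : (t.rename r).subst s = t.subst (s.precomp r) := by
  induction t generalizing Δ Θ with
  | fvar | const | bvar => rfl
  | app s t ihs iht => simp only [Tm.rename, Tm.subst, ihs, iht]
  | lam t ih => simp only [Tm.rename, Tm.subst, ih, Args.precomp_lift]

theorem Tm.rename_wk {Γ Δ : Ctx B} {τ : Ty B} (t : Tm FV C Γ τ) (r : Ren Γ Δ) (β : Ty B) :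
    (t.wk β).rename (r.lift β) = (t.rename r).wk β := by
  rw [Tm.wk_eq_rename, Tm.wk_eq_rename, Tm.rename_rename, Tm.rename_rename]
  rfl

theorem Args.rename_lift {Γ Δ Θ : Ctx B} (s : Args FV C Γ Δ) (r : Ren Δ Θ) (β : Ty B) :
    (s.lift β).rename (r.lift β) = (s.rename r).lift β := by
  funext α x
  cases x with
  | zero => rfl
  | succ x => exact Tm.rename_wk _ _ _

theorem Tm.rename_subst {Γ Δ Θ : Ctx B} {τ : Ty B} (t : Tm FV C Γ τ) (s : Args FV C Γ Δ)
    (r : Ren Δ Θ) : (t.subst s).rename r = t.subst (s.rename r) := by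
  induction t generalizing Δ Θ with
  | fvar | const | bvar => rfl
  | app s t ihs iht => simp only [Tm.rename, Tm.subst, ihs, iht]
  | lam t ih => simp only [Tm.rename, Tm.subst, ih, Args.rename_lift]

theorem Tm.subst_wk {Γ Δ : Ctx B} {τ : Ty B} (t : Tm FV C Γ τ) (s : Args FV C Γ Δ) (β : Ty B) :
    (t.wk β).subst (s.lift β) = (t.subst s).wk β := by
  rw [Tm.wk_eq_rename, Tm.wk_eq_rename, Tm.subst_rename, Tm.rename_subst]
  rfl

theorem Args.comp_lift {Γ Δ Θ : Ctx B} (s : Args FV C Γ Δ) (s' : Args FV C Δ Θ) (β : Ty B) :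
    (s.lift β).comp (s'.lift β) = (s.comp s').lift β := by
  funext α x
  cases x with
  | zero => rfl
  | succ x => exact Tm.subst_wk _ _ _

theorem Tm.subst_subst {Γ Δ Θ : Ctx B} {τ : Ty B} (t : Tm FV C Γ τ) (s : Args FV C Γ Δ)
    (s' : Args FV C Δ Θ) : (t.subst s).subst s' = t.subst (s.comp s') := by
  induction t generalizing Δ Θ with
  | fvar | const | bvar => rfl
  | app s t ihs iht => simp only [Tm.subst, ihs, iht]
  | lam t ih => simp only [Tm.subst, ih, Args.comp_lift]

theorem Args.lift_id (Γ : Ctx B) (β : Ty B) :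
    Args.lift (Args.id : Args FV C Γ Γ) β = Args.id := by
  funext α x
  cases x <;> rfl

theorem Tm.subst_id {Γ : Ctx B} {τ : Ty B} (t : Tm FV C Γ τ) : t.subst Args.id = t := by
  induction t with
  | fvar | const | bvar => rfl
  | app s t ihs iht => simp only [Tm.subst, ihs, iht]
  | lam t ih => simp only [Tm.subst, Args.lift_id, ih]

theorem Tm.rename_id {Γ : Ctx B} {τ : Ty B} (t : Tm FV C Γ τ) : t.rename Ren.id = t := by
  rw [← Tm.subst_id (t.rename Ren.id), Tm.subst_rename]
  exact t.subst_id

theorem Tm.inst_eq_subst {Γ : Ctx B} {α β : Ty B} (t : Tm FV C (α :: Γ) β) (a : Tm FV C Γ α) :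
    t.inst a = t.subst (Args.id.snoc a) := rfl

theorem Tm.rename_inst {Γ Δ : Ctx B} {α β : Ty B} (t : Tm FV C (α :: Γ) β) (a : Tm FV C Γ α)
    (r : Ren Γ Δ) : (t.inst a).rename r = (t.rename (r.lift α)).inst (a.rename r) := by
  rw [Tm.inst_eq_subst, Tm.inst_eq_subst, Tm.rename_subst, Tm.subst_rename]
  congr 1
  funext γ x
  cases x <;> rfl

theorem Tm.subst_lift_inst {Γ Δ : Ctx B} {α β : Ty B} (t : Tm FV C (α :: Γ) β) (s : Args FV C Γ Δ)
    (a : Tm FV C Δ α) : (t.subst (s.lift α)).inst a = t.subst (s.snoc a) := by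
  rw [Tm.inst_eq_subst, Tm.subst_subst]
  congr 1
  funext γ x
  cases x with
  | zero => rfl
  | succ x =>
    change ((s γ x).wk α).subst _ = s γ x
    rw [Tm.wk_eq_rename, Tm.subst_rename]
    exact Tm.subst_id _

theorem Conv.rename {Γ Δ : Ctx B} {τ : Ty B} {s t : Tm FV C Γ τ} (h : Conv s t) (r : Ren Γ Δ) :
    Conv (s.rename r) (t.rename r) := by
  induction h generalizing Δ with
  | refl => exact .refl _
  | symm _ ih => exact (ih r).symm
  | trans _ _ ih ih' => exact (ih r).trans (ih' r)
  | app _ _ ih ih' => exact .app (ih r) (ih' r)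
  | lam _ ih => exact .lam (ih _)
  | beta t a =>
    rw [Tm.rename_inst]
    exact .beta _ _
  | eta t =>
    simp only [Tm.rename, Tm.rename_wk]
    exact .eta _

/-- Renaming preserves both forms; by structural induction, so that the two clauses can refer to
each other. -/
theorem Tm.normal_rename {Γ : Ctx B} {τ : Ty B} (t : Tm FV C Γ τ) :
    ∀ {Δ : Ctx B} (r : Ren Γ Δ), (Neutral t → Neutral (t.rename r)) ∧
      (LongNormal t → LongNormal (t.rename r)) := by
  induction t with
  | fvar F =>
    refine fun r => ⟨fun _ => .fvar _, fun h => ?_⟩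
    cases h; exact .base (.fvar _)
  | const c =>
    refine fun r => ⟨fun _ => .const _, fun h => ?_⟩
    cases h; exact .base (.const _)
  | bvar x =>
    refine fun r => ⟨fun _ => .bvar _, fun h => ?_⟩
    cases h; exact .base (.bvar _)
  | app s t ihs iht =>
    intro Δ r
    have hn : Neutral (Tm.app s t) → Neutral ((Tm.app s t).rename r) := by
      intro h
      cases h with
      | app h h' => exact .app ((ihs r).1 h) ((iht r).2 h')
    refine ⟨hn, fun h => ?_⟩
    cases h with
    | base h => exact .base (hn h)
  | lam t ih =>
    refine fun r => ⟨fun h => (nomatch h), fun h => ?_⟩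
    cases h with
    | lam h => exact .lam ((ih _).2 h)

theorem Neutral.rename {Γ Δ : Ctx B} {τ : Ty B} {t : Tm FV C Γ τ} (h : Neutral t)
    (r : Ren Γ Δ) : Neutral (t.rename r) :=
  (t.normal_rename r).1 h

/-- Substituting neutral terms creates no redexes, even below binders and in head position. -/
theorem Tm.normal_subst {Γ : Ctx B} {τ : Ty B} (t : Tm FV C Γ τ) :
    ∀ {Δ : Ctx B} (s : Args FV C Γ Δ), (∀ α x, Neutral (s α x)) →
      (Neutral t → Neutral (t.subst s)) ∧ (LongNormal t → LongNormal (t.subst s)) := by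
  induction t with
  | fvar F =>
    refine fun s hs => ⟨fun _ => .fvar _, fun h => ?_⟩
    cases h; exact .base (.fvar _)
  | const c =>
    refine fun s hs => ⟨fun _ => .const _, fun h => ?_⟩
    cases h; exact .base (.const _)
  | bvar x =>
    refine fun s hs => ⟨fun _ => hs _ x, fun h => ?_⟩
    cases h; exact .base (hs _ x)
  | app t t' iht iht' =>
    intro Δ s hs
    have hn : Neutral (Tm.app t t') → Neutral ((Tm.app t t').subst s) := by
      intro h
      cases h with
      | app h h' => exact .app ((iht s hs).1 h) ((iht' s hs).2 h')
    refine ⟨hn, fun h => ?_⟩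
    cases h with
    | base h => exact .base (hn h)
  | lam t ih =>
    refine fun s hs => ⟨fun h => (nomatch h), fun h => ?_⟩
    cases h with
    | lam h =>
      refine .lam ((ih _ fun α x => ?_).2 h)
      cases x with
      | zero => exact .bvar _
      | succ x => exact (hs _ x).rename _

/-! ### Existence of long normal forms -/

/-- Tait's reducibility predicate: at base types the term is convertible to a neutral one, and at
function types all its renamings map reducible arguments to reducible results. -/
def Red : ∀ (τ : Ty B) {Γ : Ctx B}, Tm FV C Γ τ → Prop
  | .base _, _, t => ∃ n, Neutral n ∧ Conv t n
  | .arr α β, Γ, t =>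
    ∀ (Δ : Ctx B) (r : Ren Γ Δ) (a : Tm FV C Δ α), Red α a → Red β (.app (t.rename r) a)

theorem Red.conv {τ : Ty B} : ∀ {Γ : Ctx B} {t t' : Tm FV C Γ τ}, Conv t t' → Red τ t →
    Red τ t' := by
  induction τ with
  | base b => exact fun h ⟨n, hn, h'⟩ => ⟨n, hn, h.symm.trans h'⟩
  | arr α β _ ih => exact fun h ht Δ r a ha => ih (.app (h.rename r) (.refl a)) (ht Δ r a ha)

theorem Red.rename {τ : Ty B} {Γ Δ : Ctx B} {t : Tm FV C Γ τ} (h : Red τ t) (r : Ren Γ Δ) :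
    Red τ (t.rename r) := by
  cases τ with
  | base b =>
    obtain ⟨n, hn, h⟩ := h
    exact ⟨_, hn.rename r, h.rename r⟩
  | arr α β =>
    intro Θ r' a ha
    rw [Tm.rename_rename]
    exact h Θ _ a ha

/-- Reducible terms have long normal forms, and neutral terms are reducible. The two statements
need each other at function types. -/
theorem Red.reify_reflect (τ : Ty B) :
    (∀ {Γ : Ctx B} {t : Tm FV C Γ τ}, Red τ t → ∃ n, LongNormal n ∧ Conv t n) ∧
      ∀ {Γ : Ctx B} {n : Tm FV C Γ τ}, Neutral n → Red τ n := by
  induction τ with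
  | base b =>
    exact ⟨fun ⟨n, hn, h⟩ => ⟨n, .base hn, h⟩, fun {_ n} hn => ⟨n, hn, .refl n⟩⟩
  | arr α β ihα ihβ =>
    refine ⟨@fun Γ t h => ?_, @fun Γ n hn Δ r a ha => ?_⟩
    · obtain ⟨n, hn, h'⟩ := ihβ.1 (h (α :: Γ) (Ren.shift α) _ (ihα.2 (.bvar .zero)))
      refine ⟨_, .lam hn, (Conv.eta t).symm.trans (.lam h')⟩
    · obtain ⟨a', ha', h⟩ := ihα.1 ha
      exact (ihβ.2 (.app (hn.rename r) ha')).conv (.app (.refl _) h.symm)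

theorem Red.subst {Γ : Ctx B} {τ : Ty B} (t : Tm FV C Γ τ) : ∀ {Δ : Ctx B} {s : Args FV C Γ Δ},
    (∀ α x, Red α (s α x)) → Red τ (t.subst s) := by
  induction t with
  | fvar F => exact fun _ => (Red.reify_reflect _).2 (.fvar F)
  | const c => exact fun _ => (Red.reify_reflect _).2 (.const c)
  | bvar x => exact fun hs => hs _ x
  | @app Γ α β t t' iht iht' =>
    intro Δ s hs
    have h := iht hs Δ Ren.id _ (iht' hs)
    rwa [Tm.rename_id] at h
  | @lam Γ α β t ih =>
    intro Δ s hs Θ r a ha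
    refine (ih (s := (s.rename r).snoc a) fun γ x => ?_).conv ?_
    · cases x with
      | zero => exact ha
      | succ x => exact (hs _ x).rename r
    · rw [Tm.rename_subst, ← Tm.subst_lift_inst, Tm.subst]
      exact (Conv.beta _ _).symm

theorem exists_longNormal {Γ : Ctx B} {τ : Ty B} (t : Tm FV C Γ τ) :
    ∃ n, LongNormal n ∧ Conv t n := by
  have h := Red.subst t (s := Args.id) fun _ _ => (Red.reify_reflect _).2 (.bvar _)
  rw [Tm.subst_id] at h
  exact (Red.reify_reflect _).1 h

/-! ### Uniqueness of long normal forms -/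

/-- Terms in which bound variables are de Bruijn levels. As these do not change under further
binders, the terms need no context. -/
inductive LevelTm (FV : Ty B → Type v) (C : Ty B → Type w) : Ty B → Type (max u v w)
  | fvar {τ : Ty B} : FV τ → LevelTm FV C τ
  | const {τ : Ty B} : C τ → LevelTm FV C τ
  | level {τ : Ty B} : ℕ → LevelTm FV C τ
  | app {α β : Ty B} : LevelTm FV C (Ty.arr α β) → LevelTm FV C α → LevelTm FV C β
  | lam {α β : Ty B} : LevelTm FV C β → LevelTm FV C (Ty.arr α β)

/-- The full type hierarchy over the families of level terms indexed by the number of enclosing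
binders. -/
def Den (FV : Ty B → Type v) (C : Ty B → Type w) : Ty B → Type (max u v w)
  | .base b => ℕ → LevelTm FV C (.base b)
  | .arr α β => Den FV C α → Den FV C β

mutual

/-- The element of the model that stands for a neutral level term. -/
def Den.reflect : (τ : Ty B) → (ℕ → LevelTm FV C τ) → Den FV C τ
  | .base _, r => r
  | .arr α β, r => fun a => Den.reflect β fun n => .app (r n) (Den.reify α a n)

/-- Read an element of the model back as a level term below `n` binders. -/
def Den.reify : (τ : Ty B) → Den FV C τ → ℕ → LevelTm FV C τ
  | .base _, d => d
  | .arr α β, f => fun n => .lam (Den.reify β (f (Den.reflect α fun _ => .level n)) (n + 1))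

end

/-- Environments: values for the loose bound variables. -/
abbrev Env (FV : Ty B → Type v) (C : Ty B → Type w) (Γ : Ctx B) : Type (max u v w) :=
  ∀ α : Ty B, Var Γ α → Den FV C α

/-- Values for the free variables. -/
abbrev Valuation (FV : Ty B → Type v) (C : Ty B → Type w) : Type (max u v w) :=
  ∀ X : FVar FV, Den FV C X.1

/-- Extend an environment under a binder. -/
def Env.snoc {Γ : Ctx B} {α : Ty B} (ρ : Env FV C Γ) (a : Den FV C α) : Env FV C (α :: Γ)
  | _, .zero => a
  | _, .succ x => ρ _ x

/-- The value of a term in the model. Constants denote themselves. -/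
def Tm.den (φ : Valuation FV C) : ∀ {Γ : Ctx B} {τ : Ty B}, Tm FV C Γ τ → Env FV C Γ → Den FV C τ
  | _, _, .fvar F, _ => φ (fv F)
  | _, _, .const c, _ => Den.reflect _ fun _ => .const c
  | _, _, .bvar x, ρ => ρ _ x
  | _, _, .app s t, ρ => (s.den φ ρ : Den FV C (.arr _ _)) (t.den φ ρ)
  | _, _, .lam t, ρ => fun a => t.den φ (ρ.snoc a)

theorem Tm.den_rename (φ : Valuation FV C) {Γ Δ : Ctx B} {τ : Ty B} (t : Tm FV C Γ τ)
    (r : Ren Γ Δ) (ρ : Env FV C Δ) : (t.rename r).den φ ρ = t.den φ fun _ x => ρ _ (r _ x) := by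
  induction t generalizing Δ with
  | fvar | const | bvar => rfl
  | app s t ihs iht => simp only [Tm.rename, Tm.den, ihs, iht]
  | lam t ih =>
    simp only [Tm.rename, Tm.den, ih]
    funext a
    congr 1
    funext α x
    cases x <;> rfl

theorem Tm.den_wk (φ : Valuation FV C) {Γ : Ctx B} {τ β : Ty B} (t : Tm FV C Γ τ)
    (ρ : Env FV C Γ) (a : Den FV C β) : (t.wk β).den φ (ρ.snoc a) = t.den φ ρ :=
  t.den_rename φ _ _

theorem Tm.den_subst (φ : Valuation FV C) {Γ Δ : Ctx B} {τ : Ty B} (t : Tm FV C Γ τ)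
    (s : Args FV C Γ Δ) (ρ : Env FV C Δ) :
    (t.subst s).den φ ρ = t.den φ fun _ x => (s _ x).den φ ρ := by
  induction t generalizing Δ with
  | fvar | const | bvar => rfl
  | app s t ihs iht => simp only [Tm.subst, Tm.den, ihs, iht]
  | lam t ih =>
    simp only [Tm.subst, Tm.den, ih]
    funext a
    congr 1
    funext α x
    cases x with
    | zero => rfl
    | succ x => exact Tm.den_wk φ _ _ _

theorem Conv.den_eq {Γ : Ctx B} {τ : Ty B} {s t : Tm FV C Γ τ} (h : Conv s t)
    (φ : Valuation FV C) (ρ : Env FV C Γ) : s.den φ ρ = t.den φ ρ := by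
  induction h with
  | refl => rfl
  | symm _ ih => exact (ih ρ).symm
  | trans _ _ ih ih' => exact (ih ρ).trans (ih' ρ)
  | app _ _ ih ih' => simp only [Tm.den, ih, ih']
  | lam _ ih => exact funext fun a => ih _
  | beta t a =>
    rw [Tm.inst, Tm.den_subst]
    change t.den φ (ρ.snoc (a.den φ ρ)) = _
    congr 1
    funext α x
    cases x <;> rfl
  | eta t =>
    funext a
    simp only [Tm.den, Tm.den_wk]
    rfl

/-- Extend an assignment of levels under a binder. -/
def levelSnoc {Γ : Ctx B} (e : ∀ α, Var Γ α → ℕ) (n : ℕ) (β : Ty B) : ∀ α, Var (β :: Γ) α → ℕ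
  | _, .zero => n
  | _, .succ x => e _ x

/-- Translate de Bruijn indices into levels: `e` gives the levels of the loose bound variables and
`n` is the next unused level. -/
def Tm.toLevel : ∀ {Γ : Ctx B} {τ : Ty B}, Tm FV C Γ τ → (∀ α, Var Γ α → ℕ) → ℕ → LevelTm FV C τ
  | _, _, .fvar F, _, _ => .fvar F
  | _, _, .const c, _, _ => .const c
  | _, _, .bvar x, e, _ => .level (e _ x)
  | _, _, .app s t, e, n => .app (s.toLevel e n) (t.toLevel e n)
  | _, _, .lam t, e, n => .lam (t.toLevel (levelSnoc e n _) (n + 1))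

theorem Tm.toLevel_injective {Γ : Ctx B} {τ : Ty B} (s t : Tm FV C Γ τ) (e : ∀ α, Var Γ α → ℕ)
    (n : ℕ) (he : ∀ α, Function.Injective (e α)) (hn : ∀ α x, e α x < n)
    (h : s.toLevel e n = t.toLevel e n) : s = t := by
  induction s generalizing n with
  | fvar F =>
    cases t <;> simp only [Tm.toLevel, LevelTm.fvar.injEq, reduceCtorEq] at h
    rw [h]
  | const c =>
    cases t <;> simp only [Tm.toLevel, LevelTm.const.injEq, reduceCtorEq] at h
    rw [h]
  | bvar x =>
    cases t <;> simp only [Tm.toLevel, LevelTm.level.injEq, reduceCtorEq] at h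
    rw [he _ h]
  | app s s' ihs ihs' =>
    cases t <;> simp only [Tm.toLevel, LevelTm.app.injEq, reduceCtorEq] at h
    obtain ⟨rfl, h, h'⟩ := h
    rw [ihs _ e n he hn (eq_of_heq h), ihs' _ e n he hn (eq_of_heq h')]
  | lam s ih =>
    cases t <;> simp only [Tm.toLevel, LevelTm.lam.injEq, reduceCtorEq] at h
    rw [ih _ _ _ _ _ h]
    · intro α x y hxy
      cases x with
      | zero =>
        cases y with
        | zero => rfl
        | succ y => exact absurd hxy.symm (hn _ y).ne
      | succ x =>
        cases y with
        | zero => exact absurd hxy (hn _ x).ne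
        | succ y => exact congrArg _ (he _ hxy)
    · intro α x
      cases x with
      | zero => exact Nat.lt_succ_self n
      | succ x => exact (hn _ x).trans (Nat.lt_succ_self n)

/-- The valuation that maps every free variable to itself. -/
def Valuation.self (FV : Ty B → Type v) (C : Ty B → Type w) : Valuation FV C :=
  fun X => Den.reflect _ fun _ => .fvar X.2

/-- The environment that maps every loose bound variable to its level. -/
def levelEnv (FV : Ty B → Type v) (C : Ty B → Type w) {Γ : Ctx B} (e : ∀ α, Var Γ α → ℕ) :
    Env FV C Γ :=
  fun α x => Den.reflect α fun _ => .level (e α x)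

theorem levelEnv_snoc {Γ : Ctx B} (e : ∀ α, Var Γ α → ℕ) (n : ℕ) (β : Ty B) :
    (levelEnv FV C e).snoc (Den.reflect β fun _ => .level n) =
      levelEnv FV C (levelSnoc e n β) := by
  funext α x
  cases x <;> rfl

/-- A long normal form can be read off from its value. -/
theorem Tm.reify_den {Γ : Ctx B} {τ : Ty B} (t : Tm FV C Γ τ) : ∀ e : ∀ α, Var Γ α → ℕ,
    (Neutral t → t.den (.self FV C) (levelEnv FV C e) = Den.reflect τ fun n => t.toLevel e n) ∧
      (LongNormal t →
        Den.reify τ (t.den (.self FV C) (levelEnv FV C e)) = fun n => t.toLevel e n) := by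
  induction t with
  | fvar F => exact fun e => ⟨fun _ => rfl, fun h => by cases h; simp only [Den.reify]; rfl⟩
  | const c => exact fun e => ⟨fun _ => rfl, fun h => by cases h; simp only [Den.reify]; rfl⟩
  | bvar x => exact fun e => ⟨fun _ => rfl, fun h => by cases h; simp only [Den.reify]; rfl⟩
  | app s t ihs iht =>
    intro e
    have hn : Neutral (Tm.app s t) → (Tm.app s t).den (.self FV C) (levelEnv FV C e) =
        Den.reflect _ fun n => (Tm.app s t).toLevel e n := by
      intro h
      cases h with
      | app h h' =>
        simp only [Tm.den, (ihs e).1 h, Den.reflect, (iht e).2 h', Tm.toLevel]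
    refine ⟨hn, fun h => ?_⟩
    cases h with
    | base h => rw [hn h]; simp only [Den.reify, Den.reflect]
  | lam t ih =>
    refine fun e => ⟨fun h => (by cases h), fun h => ?_⟩
    cases h with
    | lam h =>
      funext n
      simp only [Den.reify, Tm.den, levelEnv_snoc, (ih _).2 h, Tm.toLevel]

/-- The level of a loose bound variable, counted from the outermost one. -/
def Var.level : ∀ {Γ : Ctx B} {α : Ty B}, Var Γ α → ℕ
  | _ :: Γ, _, .zero => Γ.length
  | _, _, .succ x => x.level

theorem Var.level_lt {Γ : Ctx B} {α : Ty B} (x : Var Γ α) : x.level < Γ.length := by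
  induction x with
  | zero => exact Nat.lt_succ_self _
  | succ x ih => exact ih.trans (Nat.lt_succ_self _)

theorem Var.level_injective {Γ : Ctx B} {α : Ty B} :
    Function.Injective (Var.level : Var Γ α → ℕ) := by
  intro x y h
  induction x with
  | zero =>
    cases y with
    | zero => rfl
    | succ y => exact absurd h.symm y.level_lt.ne
  | succ x ih =>
    cases y with
    | zero => exact absurd h x.level_lt.ne
    | succ y => exact congrArg _ (ih h)

/-- Uniqueness of long normal forms: those with the same values are equal. -/
theorem LongNormal.eq_of_den_eq {Γ : Ctx B} {τ : Ty B} {s t : Tm FV C Γ τ} (hs : LongNormal s)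
    (ht : LongNormal t) (h : ∀ φ ρ, s.den φ ρ = t.den φ ρ) : s = t := by
  refine Tm.toLevel_injective s t (fun _ => Var.level) Γ.length (fun _ => Var.level_injective)
    (fun _ => Var.level_lt) ?_
  have h' := (s.reify_den fun _ => Var.level).2 hs
  rw [h, (t.reify_den fun _ => Var.level).2 ht] at h'
  exact (congrFun h' _).symm

/-- Soundness and completeness of the model: convertible terms are those with the same values. -/
theorem conv_iff_den {Γ : Ctx B} {τ : Ty B} {s t : Tm FV C Γ τ} :
    Conv s t ↔ ∀ φ ρ, s.den φ ρ = t.den φ ρ := by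
  refine ⟨Conv.den_eq, fun h => ?_⟩
  obtain ⟨n, hn, hsn⟩ := exists_longNormal s
  obtain ⟨m, hm, htm⟩ := exists_longNormal t
  have : n = m := hn.eq_of_den_eq hm fun φ ρ => by rw [← hsn.den_eq, ← htm.den_eq, h]
  subst this
  exact hsn.trans htm.symm

/-! ### Free variables in the model -/

theorem Tm.den_congr {Γ : Ctx B} {τ : Ty B} (t : Tm FV C Γ τ) {φ φ' : Valuation FV C}
    (h : ∀ X, t.Occurs X → φ X = φ' X) (ρ : Env FV C Γ) : t.den φ ρ = t.den φ' ρ := by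
  induction t with
  | fvar F => exact h _ rfl
  | const | bvar => rfl
  | app s t ihs iht =>
    simp only [Tm.den, ihs (fun X hX => h X (.inl hX)), iht (fun X hX => h X (.inr hX))]
  | lam t ih => exact funext fun a => ih h _

theorem Tm.Ground.den_eq {Γ : Ctx B} {τ : Ty B} {t : Tm FV C Γ τ} (h : t.Ground)
    (φ φ' : Valuation FV C) (ρ : Env FV C Γ) : t.den φ ρ = t.den φ' ρ :=
  t.den_congr (fun X hX => absurd hX (h X)) ρ

/-- The valuation that a substitution for free variables induces. -/
def FSubst.den {Γ : Ctx B} (σ : FSubst FV C Γ) (φ : Valuation FV C) (ρ : Env FV C Γ) :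
    Valuation FV C :=
  fun X => (σ X).den φ ρ

theorem Tm.den_fsubst {Γ : Ctx B} {τ : Ty B} (t : Tm FV C Γ τ) (σ : FSubst FV C Γ)
    (φ : Valuation FV C) (ρ : Env FV C Γ) : (t.fsubst σ).den φ ρ = t.den (σ.den φ ρ) ρ := by
  induction t with
  | fvar | const | bvar => rfl
  | app s t ihs iht => simp only [Tm.fsubst, Tm.den, ihs, iht]
  | lam t ih =>
    funext a
    refine (ih (fun X => (σ X).wk _) _).trans ?_
    change t.den _ _ = t.den _ _
    congr 1
    funext X
    exact Tm.den_wk _ _ _ _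

open Classical in
theorem FSubst.bind_self {Γ : Ctx B} (σ : FSubst FV C Γ) {τ : Ty B} (F : FV τ)
    (t : Tm FV C Γ τ) : σ.bind F t (fv F) = t :=
  Function.update_self (β := fun X : FVar FV => Tm FV C Γ X.1) _ _ _

open Classical in
theorem FSubst.bind_of_ne {Γ : Ctx B} (σ : FSubst FV C Γ) {τ : Ty B} {F : FV τ}
    (t : Tm FV C Γ τ) {X : FVar FV} (h : X ≠ fv F) : σ.bind F t X = σ X :=
  Function.update_of_ne (β := fun X : FVar FV => Tm FV C Γ X.1) h _ _

/-- Substituting terms for bound variables keeps all occurrences of free variables. -/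
theorem Tm.Occurs.subst {X : FVar FV} {Γ : Ctx B} {τ : Ty B} {t : Tm FV C Γ τ} (h : t.Occurs X) :
    ∀ {Δ : Ctx B} (s : Args FV C Γ Δ), (t.subst s).Occurs X := by
  induction t with
  | fvar F => exact fun s => h
  | const | bvar => exact h.elim
  | app s t ihs iht => exact fun a => h.imp (fun h => ihs h a) (fun h => iht h a)
  | lam t ih => exact fun s => ih h _

theorem Tm.Ground.of_subst {Γ Δ : Ctx B} {τ : Ty B} {t : Tm FV C Γ τ} {s : Args FV C Γ Δ}
    (h : (t.subst s).Ground) : t.Ground :=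
  fun X hX => h X (hX.subst s)

/-! ### Iterated abstraction and application in the model -/

/-- Iterated application in the model. -/
def Den.apps : (Δ : Ctx B) → {τ : Ty B} → Den FV C (arrows Δ τ) → Env FV C Δ → Den FV C τ
  | [], _, f, _ => f
  | α :: Δ, τ, f, ξ =>
    (Den.apps Δ (τ := .arr α τ) f fun _ x => ξ _ (.succ x) : Den FV C (.arr α τ)) (ξ _ .zero)

theorem Den.apps_injective {Δ : Ctx B} {τ : Ty B} {f g : Den FV C (arrows Δ τ)}
    (h : ∀ ξ, Den.apps Δ f ξ = Den.apps Δ g ξ) : f = g := by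
  induction Δ generalizing τ with
  | nil => exact h fun _ x => nomatch x
  | cons α Δ ih => exact ih (τ := .arr α τ) fun ξ => funext fun a => h (ξ.snoc a)

/-- Concatenation of environments. -/
def Env.append {Γ : Ctx B} : {Δ : Ctx B} → Env FV C Δ → Env FV C Γ → Env FV C (Δ ++ Γ)
  | [], _, ρ => ρ
  | _ :: Δ, ξ, ρ => (Env.append (Δ := Δ) (fun _ x => ξ _ (.succ x)) ρ).snoc (ξ _ .zero)

theorem Env.append_inl {Γ Δ : Ctx B} (ξ : Env FV C Δ) (ρ : Env FV C Γ) {α : Ty B}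
    (x : Var Δ α) : ξ.append ρ α x.inl = ξ α x := by
  induction x with
  | zero => rfl
  | succ x ih => exact ih _

theorem Env.append_inr {Γ Δ : Ctx B} (ξ : Env FV C Δ) (ρ : Env FV C Γ) {α : Ty B}
    (x : Var Γ α) : ξ.append ρ α (x.inr Δ) = ρ α x := by
  induction Δ with
  | nil => rfl
  | cons β Δ ih => exact ih _

theorem Var.inl_or_inr {Γ Δ : Ctx B} {α : Ty B} (x : Var (Δ ++ Γ) α) :
    (∃ y : Var Δ α, x = y.inl) ∨ ∃ y : Var Γ α, x = y.inr Δ := by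
  induction Δ with
  | nil => exact .inr ⟨x, rfl⟩
  | cons β Δ ih =>
    cases x with
    | zero => exact .inl ⟨.zero, rfl⟩
    | succ x =>
      obtain ⟨y, rfl⟩ | ⟨y, rfl⟩ := ih x
      · exact .inl ⟨.succ y, rfl⟩
      · exact .inr ⟨y, rfl⟩

theorem Env.ext_append {Γ Δ : Ctx B} {ρ ρ' : Env FV C (Δ ++ Γ)}
    (hl : ∀ α (x : Var Δ α), ρ α x.inl = ρ' α x.inl)
    (hr : ∀ α (x : Var Γ α), ρ α (x.inr Δ) = ρ' α (x.inr Δ)) : ρ = ρ' := by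
  funext α x
  obtain ⟨y, rfl⟩ | ⟨y, rfl⟩ := x.inl_or_inr
  exacts [hl α y, hr α y]

theorem Env.exists_append {Γ Δ : Ctx B} (ρ : Env FV C (Δ ++ Γ)) :
    ∃ (ξ : Env FV C Δ) (ρ' : Env FV C Γ), ρ = ξ.append ρ' :=
  ⟨fun _ x => ρ _ x.inl, fun _ x => ρ _ (x.inr Δ), Env.ext_append
    (fun _ x => (Env.append_inl (fun _ x => ρ _ x.inl) _ x).symm)
    fun _ x => (Env.append_inr _ (fun _ x => ρ _ (x.inr Δ)) x).symm⟩

/-- The values of a tuple of terms. -/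
def Args.den {Δ Γ : Ctx B} (s : Args FV C Δ Γ) (φ : Valuation FV C) (ρ : Env FV C Γ) :
    Env FV C Δ :=
  fun _ x => (s _ x).den φ ρ

theorem Tm.den_subst' {Γ Δ : Ctx B} {τ : Ty B} (t : Tm FV C Γ τ) (s : Args FV C Γ Δ)
    (φ : Valuation FV C) (ρ : Env FV C Δ) : (t.subst s).den φ ρ = t.den φ (s.den φ ρ) :=
  t.den_subst φ s ρ

theorem den_lams (φ : Valuation FV C) {Γ : Ctx B} (Δ : Ctx B) {τ : Ty B}
    (t : Tm FV C (Δ ++ Γ) τ) (ρ : Env FV C Γ) (ξ : Env FV C Δ) :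
    Den.apps Δ ((lams Δ t).den φ ρ) ξ = t.den φ (ξ.append ρ) := by
  induction Δ generalizing τ with
  | nil => rfl
  | cons α Δ ih => exact congrFun (ih (.lam t) fun _ x => ξ _ (.succ x)) (ξ _ .zero)

theorem den_apps (φ : Valuation FV C) {Γ : Ctx B} (Δ : Ctx B) {τ : Ty B}
    (t : Tm FV C Γ (arrows Δ τ)) (s : Args FV C Δ Γ) (ρ : Env FV C Γ) :
    (apps Δ t s).den φ ρ = Den.apps Δ (t.den φ ρ) (s.den φ ρ) := by
  induction Δ generalizing τ with
  | nil => rfl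
  | cons α Δ ih =>
    exact congrFun (ih (τ := .arr α τ) t fun _ x => s _ (.succ x)) ((s _ .zero).den φ ρ)

theorem Tm.den_wks (φ : Valuation FV C) {Γ Δ : Ctx B} {τ : Ty B} (t : Tm FV C Γ τ)
    (ξ : Env FV C Δ) (ρ : Env FV C Γ) : (t.wks Δ).den φ (ξ.append ρ) = t.den φ ρ := by
  refine (t.den_rename φ _ _).trans ?_
  congr 1
  funext α x
  exact Env.append_inr _ _ _

theorem den_boundVars (φ : Valuation FV C) {Γ Δ : Ctx B} (ξ : Env FV C Δ) (ρ : Env FV C Γ) :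
    (boundVars FV C Γ Δ).den φ (ξ.append ρ) = ξ :=
  funext fun _ => funext fun _ => Env.append_inl _ _ _

/-- The body of the abstraction `f`, that is, `f` applied to the bound variables `x_1, …, x_m`. -/
def body {Γ : Ctx B} (Δ : Ctx B) {τ : Ty B} (f : Tm FV C Γ (arrows Δ τ)) : Tm FV C (Δ ++ Γ) τ :=
  apps Δ (f.wks Δ) (boundVars FV C Γ Δ)

theorem den_body (φ : Valuation FV C) {Γ : Ctx B} (Δ : Ctx B) {τ : Ty B}
    (f : Tm FV C Γ (arrows Δ τ)) (ξ : Env FV C Δ) (ρ : Env FV C Γ) :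
    (body Δ f).den φ (ξ.append ρ) = Den.apps Δ (f.den φ ρ) ξ := by
  rw [body, den_apps, Tm.den_wks, den_boundVars]

/-- The simultaneous substitution of the tuple `s` for the variables in `αs` that fixes those
in `Γ`. -/
def Args.over {Γ Δ αs : Ctx B} (s : Args FV C αs (Δ ++ Γ)) : Args FV C (αs ++ Γ) (Δ ++ Γ) :=
  Args.append (fun _ x => .bvar (x.inr Δ)) αs s

theorem Args.append_inl {Δ Δ' Γ : Ctx B} (s : Args FV C Δ Γ) (t : Args FV C Δ' Γ) {α : Ty B}
    (x : Var Δ' α) : s.append Δ' t α x.inl = t α x := by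
  induction x with
  | zero => rfl
  | succ x ih => exact ih _

theorem Args.append_inr {Δ Δ' Γ : Ctx B} (s : Args FV C Δ Γ) (t : Args FV C Δ' Γ) {α : Ty B}
    (x : Var Δ α) : s.append Δ' t α (x.inr Δ') = s α x := by
  induction Δ' with
  | nil => rfl
  | cons β Δ ih => exact ih _

theorem Args.over_inl {Γ Δ αs : Ctx B} (s : Args FV C αs (Δ ++ Γ)) {α : Ty B} (x : Var αs α) :
    s.over α x.inl = s α x :=
  Args.append_inl _ _ _

theorem Args.over_inr {Γ Δ αs : Ctx B} (s : Args FV C αs (Δ ++ Γ)) {α : Ty B} (x : Var Γ α) :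
    s.over α (x.inr αs) = .bvar (x.inr Δ) :=
  Args.append_inr _ _ _

theorem Args.den_over (φ : Valuation FV C) {Γ Δ αs : Ctx B} (s : Args FV C αs (Δ ++ Γ))
    (δ : Env FV C Δ) (ρ : Env FV C Γ) :
    s.over.den φ (δ.append ρ) = (s.den φ (δ.append ρ)).append ρ := by
  refine Env.ext_append (fun α x => ?_) fun α x => ?_
  · rw [Args.den, Args.over_inl, Env.append_inl, Args.den]
  · rw [Args.den, Args.over_inr, Env.append_inr, Tm.den, Env.append_inr]

theorem den_flexTerm (φ : Valuation FV C) {Γ Δ αs : Ctx B} {β : Ty B} (F : FV (arrows αs β))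
    (s : Args FV C αs (Δ ++ Γ)) (ρ : Env FV C Γ) (δ : Env FV C Δ) :
    Den.apps Δ ((flexTerm Δ F s).den φ ρ) δ =
      Den.apps αs (φ (fv F)) (s.den φ (δ.append ρ)) := by
  rw [flexTerm, den_lams, den_apps, Tm.den]

/-! ### Solid flexible terms -/

theorem LongNormal.of_lams {Γ Δ : Ctx B} {τ : Ty B} {t : Tm FV C (Δ ++ Γ) τ}
    (h : LongNormal (lams Δ t)) : LongNormal t := by
  induction Δ generalizing τ with
  | nil => exact h
  | cons α Δ ih =>
    cases ih h with
    | lam h => exact h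

theorem Neutral.of_apps {Γ αs : Ctx B} {τ : Ty B} {f : Tm FV C Γ (arrows αs τ)}
    {s : Args FV C αs Γ} (h : Neutral (apps αs f s)) : ∀ α i, LongNormal (s α i) := by
  induction αs generalizing τ with
  | nil => exact fun _ i => nomatch i
  | cons α αs ih =>
    intro γ i
    cases h with
    | app h h' =>
      cases i with
      | zero => exact h'
      | succ i => exact ih h γ i

theorem Tm.FlexArgsSolid.of_lams {Γ Δ : Ctx B} {τ : Ty B} {t : Tm FV C (Δ ++ Γ) τ}
    (h : (lams Δ t).FlexArgsSolid) : t.FlexArgsSolid := by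
  induction Δ generalizing τ with
  | nil => exact h
  | cons α Δ ih => exact ih (t := .lam t) h

theorem Tm.flex_apps {Γ αs : Ctx B} {τ : Ty B} {f : Tm FV C Γ (arrows αs τ)} (hf : f.Flex)
    (s : Args FV C αs Γ) : (apps αs f s).Flex := by
  induction αs generalizing τ with
  | nil => exact hf
  | cons α αs ih => exact ih (τ := .arr α τ) hf _

theorem Tm.FlexArgsSolid.of_apps {Γ αs : Ctx B} {τ : Ty B} {f : Tm FV C Γ (arrows αs τ)}
    (hf : f.Flex) {s : Args FV C αs Γ} (h : (apps αs f s).FlexArgsSolid) :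
    ∀ α i, (s α i).SolidArg := by
  induction αs generalizing τ with
  | nil => exact fun _ i => nomatch i
  | cons α αs ih =>
    intro γ i
    cases i with
    | zero => exact h.2.2 (Tm.flex_apps (τ := .arr α τ) hf _)
    | succ i => exact ih (τ := .arr α τ) hf h.1 γ i

theorem Tm.Solid.args_longNormal {Γ Δ αs : Ctx B} {b : B} {F : FV (arrows αs (.base b))}
    {s : Args FV C αs (Δ ++ Γ)} (h : (flexTerm Δ F s).Solid) (α : Ty B) (i : Var αs α) :
    LongNormal (s α i) := by
  cases h.1.of_lams with
  | base h => exact h.of_apps α i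

theorem Tm.Solid.args_solidArg {Γ Δ αs : Ctx B} {b : B} {F : FV (arrows αs (.base b))}
    {s : Args FV C αs (Δ ++ Γ)} (h : (flexTerm Δ F s).Solid) (α : Ty B) (i : Var αs α) :
    (s α i).SolidArg :=
  h.2.of_lams.of_apps (f := .fvar F) (by simp only [Tm.Flex]) α i

theorem Tm.occurs_lams {X : FVar FV} {Γ Δ : Ctx B} {τ : Ty B} {t : Tm FV C (Δ ++ Γ) τ}
    (h : (lams Δ t).Occurs X) : t.Occurs X := by
  induction Δ generalizing τ with
  | nil => exact h
  | cons α Δ ih => exact ih (t := .lam t) h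

theorem Tm.occurs_apps {X : FVar FV} {Γ αs : Ctx B} {τ : Ty B} {f : Tm FV C Γ (arrows αs τ)}
    {s : Args FV C αs Γ} (h : (apps αs f s).Occurs X) :
    f.Occurs X ∨ ∃ α i, (s α i).Occurs X := by
  induction αs generalizing τ with
  | nil => exact .inl h
  | cons α αs ih =>
    obtain h | h := h
    · obtain h | ⟨γ, i, h⟩ := ih (τ := .arr α τ) h
      · exact .inl h
      · exact .inr ⟨γ, _, h⟩
    · exact .inr ⟨α, _, h⟩

theorem eq_of_occurs_flexTerm {X : FVar FV} {Γ Δ αs : Ctx B} {β : Ty B} {F : FV (arrows αs β)}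
    {s : Args FV C αs (Δ ++ Γ)} (hs : ∀ α i, (s α i).Ground) (h : (flexTerm Δ F s).Occurs X) :
    X = fv F := by
  obtain h | ⟨α, i, h⟩ := Tm.occurs_apps (Tm.occurs_lams h)
  · exact h
  · exact absurd h (hs α i X)

/-- Renaming free variables preserves both forms. -/
theorem Tm.normal_fsubst_fvar (f : ∀ X : FVar FV, FV X.1) {Γ : Ctx B} {τ : Ty B}
    (t : Tm FV C Γ τ) :
    (Neutral t → Neutral (t.fsubst fun X => .fvar (f X))) ∧
      (LongNormal t → LongNormal (t.fsubst fun X => .fvar (f X))) := by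
  induction t with
  | fvar F =>
    refine ⟨fun _ => .fvar _, fun h => ?_⟩
    cases h; exact .base (.fvar _)
  | const c =>
    refine ⟨fun _ => .const _, fun h => ?_⟩
    cases h; exact .base (.const _)
  | bvar x =>
    refine ⟨fun _ => .bvar _, fun h => ?_⟩
    cases h; exact .base (.bvar _)
  | app s t ihs iht =>
    have hn : Neutral (Tm.app s t) → Neutral ((Tm.app s t).fsubst fun X => .fvar (f X)) := by
      intro h
      cases h with
      | app h h' => exact .app (ihs.1 h) (iht.2 h')
    refine ⟨hn, fun h => ?_⟩
    cases h with
    | base h => exact .base (hn h)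
  | lam t ih =>
    refine ⟨fun h => (nomatch h), fun h => ?_⟩
    cases h with
    | lam h => exact .lam (ih.2 h)

theorem Tm.not_occurs_of_fsubst_fvar_eq {f : ∀ X : FVar FV, FV X.1} {Γ : Ctx B} {τ : Ty B}
    {t : Tm FV C Γ τ} (h : (t.fsubst fun X => .fvar (f X)) = t) {X : FVar FV}
    (hX : f X ≠ X.2) : ¬ t.Occurs X := by
  induction t with
  | fvar F =>
    rintro rfl
    exact hX (Tm.fvar.inj h)
  | const | bvar => exact id
  | app s t ihs iht =>
    simp only [Tm.fsubst, Tm.app.injEq, heq_eq_eq, true_and] at h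
    rintro (h' | h')
    exacts [ihs h.1 h', iht h.2 h']
  | lam t ih => exact ih (Tm.lam.inj h)

/-- The long normal form of a bound variable is ground: renaming a free variable of it would not
change its value, and hence not the term. -/
theorem LongNormal.ground_of_conv_bvar [∀ τ, Infinite (FV τ)] {Γ : Ctx B} {τ : Ty B}
    {t : Tm FV C Γ τ} (ht : LongNormal t) {x : Var Γ τ} (h : Conv t (.bvar x)) : t.Ground := by
  choose f hf using fun X : FVar FV => exists_ne X.2
  refine fun X => Tm.not_occurs_of_fsubst_fvar_eq (f := f) ?_ (hf X)
  refine ((t.normal_fsubst_fvar f).2 ht).eq_of_den_eq ht fun φ ρ => ?_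
  refine (Tm.den_fsubst _ _ _ _).trans ?_
  rw [h.den_eq, h.den_eq]
  rfl

theorem Tm.SolidArg.ground [∀ τ, Infinite (FV τ)] {Γ : Ctx B} {τ : Ty B} {t : Tm FV C Γ τ}
    (h : t.SolidArg) (ht : LongNormal t) : t.Ground := by
  obtain ⟨x, hx⟩ | h := h
  exacts [ht.ground_of_conv_bvar hx, h.2]

theorem Tm.SolidArg.exists_neutral {Γ : Ctx B} {τ : Ty B} {t : Tm FV C Γ τ} (h : t.SolidArg)
    (ht : LongNormal t) : ∃ n, Neutral n ∧ Conv t n := by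
  obtain ⟨x, hx⟩ | ⟨⟨b, rfl⟩, -⟩ := h
  · exact ⟨_, .bvar x, hx⟩
  · cases ht with
    | base h => exact ⟨t, h, .refl t⟩

/-- The neutral terms `n` are representatives of the ground, long normal terms `s`. The former
may be substituted into normal forms without creating redexes. -/
structure NeutralForms {Γ αs : Ctx B} (s n : Args FV C αs Γ) : Prop where
  ground : ∀ α i, (s α i).Ground
  longNormal : ∀ α i, LongNormal (s α i)
  neutral : ∀ α i, Neutral (n α i)
  conv : ∀ α i, Conv (s α i) (n α i)

theorem Tm.Solid.exists_neutralForms [∀ τ, Infinite (FV τ)] {Γ Δ αs : Ctx B} {b : B}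
    {F : FV (arrows αs (.base b))} {s : Args FV C αs (Δ ++ Γ)} (h : (flexTerm Δ F s).Solid) :
    ∃ n, NeutralForms s n := by
  choose n hn using fun α i => (h.args_solidArg α i).exists_neutral (h.args_longNormal α i)
  exact ⟨n, fun α i => (h.args_solidArg α i).ground (h.args_longNormal α i),
    h.args_longNormal, fun α i => (hn α i).1, fun α i => (hn α i).2⟩

theorem NeutralForms.den_eq {Γ αs : Ctx B} {s n : Args FV C αs Γ} (h : NeutralForms s n)
    (φ φ' : Valuation FV C) (ρ : Env FV C Γ) : s.den φ ρ = s.den φ' ρ :=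
  funext fun α => funext fun i => (h.ground α i).den_eq φ φ' ρ

theorem NeutralForms.den_neutral {Γ αs : Ctx B} {s n : Args FV C αs Γ} (h : NeutralForms s n)
    (φ : Valuation FV C) (ρ : Env FV C Γ) : n.den φ ρ = s.den φ ρ :=
  funext fun α => funext fun i => ((h.conv α i).den_eq φ ρ).symm

theorem NeutralForms.neutral_over {Γ Δ αs : Ctx B} {s n : Args FV C αs (Δ ++ Γ)}
    (h : NeutralForms s n) (α : Ty B) (x : Var (αs ++ Γ) α) : Neutral (n.over α x) := by
  obtain ⟨y, rfl⟩ | ⟨y, rfl⟩ := x.inl_or_inr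
  · rw [Args.over_inl]
    exact h.neutral α y
  · rw [Args.over_inr]
    exact .bvar _

theorem NeutralForms.den_subst_over {Γ Δ αs : Ctx B} {s n : Args FV C αs (Δ ++ Γ)}
    (h : NeutralForms s n) {τ : Ty B} (t : Tm FV C (αs ++ Γ) τ) (φ : Valuation FV C)
    (δ : Env FV C Δ) (ρ : Env FV C Γ) :
    (t.subst n.over).den φ (δ.append ρ) = t.den φ ((s.den φ (δ.append ρ)).append ρ) := by
  rw [Tm.den_subst', Args.den_over, h.den_neutral]

theorem conv_lams_iff {Γ Δ : Ctx B} {τ : Ty B} {f g : Tm FV C Γ (arrows Δ τ)} :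
    Conv f g ↔ ∀ φ ρ δ, Den.apps Δ (f.den φ ρ) δ = Den.apps Δ (g.den φ ρ) δ := by
  rw [conv_iff_den]
  exact ⟨fun h φ ρ δ => by rw [h], fun h φ ρ => Den.apps_injective (h φ ρ)⟩

/-! ### Comparing instances of terms -/

theorem Tm.rename_injective {Γ Δ : Ctx B} {τ : Ty B} {r : Ren Γ Δ}
    (hr : ∀ α, Function.Injective (r α)) {t t' : Tm FV C Γ τ} (h : t.rename r = t'.rename r) :
    t = t' := by
  induction t generalizing Δ with
  | fvar F =>
    cases t' <;> simp only [Tm.rename, Tm.fvar.injEq, reduceCtorEq] at h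
    rw [h]
  | const c =>
    cases t' <;> simp only [Tm.rename, Tm.const.injEq, reduceCtorEq] at h
    rw [h]
  | bvar x =>
    cases t' <;> simp only [Tm.rename, Tm.bvar.injEq, reduceCtorEq] at h
    rw [hr _ h]
  | app s s' ihs ihs' =>
    cases t' <;> simp only [Tm.rename, Tm.app.injEq, reduceCtorEq] at h
    obtain ⟨rfl, h, h'⟩ := h
    rw [ihs hr (eq_of_heq h), ihs' hr (eq_of_heq h')]
  | lam s ih =>
    cases t' <;> simp only [Tm.rename, Tm.lam.injEq, reduceCtorEq] at h
    rw [ih _ h]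
    intro α x y hxy
    cases x with
    | zero =>
      cases y with
      | zero => rfl
      | succ y => cases hxy
    | succ x =>
      cases y with
      | zero => cases hxy
      | succ y => exact congrArg _ (hr _ (Var.succ.inj hxy))

theorem Tm.wk_injective {Γ : Ctx B} {τ β : Ty B} {t t' : Tm FV C Γ τ} (h : t.wk β = t'.wk β) :
    t = t' :=
  Tm.rename_injective (r := Ren.shift β) (fun _ _ _ h => Var.succ.inj h) h

/-- If two substitutions agree on `t`, then all variables of `t` are among those on which the
substitutions agree. -/
theorem Tm.exists_rename_of_subst_eq {Λ₀ Λ Θ : Ctx B} {τ : Ty B} (t : Tm FV C Λ τ)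
    {a a' : Args FV C Λ Θ} (r : Ren Λ₀ Λ) (hr : ∀ α x, a α x = a' α x → ∃ y, r α y = x)
    (h : t.subst a = t.subst a') : ∃ t₀ : Tm FV C Λ₀ τ, t₀.rename r = t := by
  induction t generalizing Θ Λ₀ with
  | fvar F => exact ⟨.fvar F, rfl⟩
  | const c => exact ⟨.const c, rfl⟩
  | bvar x =>
    obtain ⟨y, rfl⟩ := hr _ x h
    exact ⟨.bvar y, rfl⟩
  | app s t ihs iht =>
    simp only [Tm.subst, Tm.app.injEq, heq_eq_eq, true_and] at h
    obtain ⟨s₀, rfl⟩ := ihs r hr h.1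
    obtain ⟨t₀, rfl⟩ := iht r hr h.2
    exact ⟨.app s₀ t₀, rfl⟩
  | @lam _ β _ t ih =>
    have hr' : ∀ α x, a.lift β α x = a'.lift β α x → ∃ y, r.lift β α y = x := by
      intro α x hx
      cases x with
      | zero => exact ⟨.zero, rfl⟩
      | succ x =>
        obtain ⟨y, rfl⟩ := hr _ x (Tm.wk_injective hx)
        exact ⟨.succ y, rfl⟩
    obtain ⟨t₀, rfl⟩ := ih (r.lift _) hr' (Tm.lam.inj h)
    exact ⟨.lam t₀, rfl⟩

/-- Strengthening: if the new variable does not occur in `t[a]`, then it does not occur in `t`. -/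
theorem Tm.exists_wk_of_subst_lift_eq {Λ Θ : Ctx B} {τ β : Ty B} {t : Tm FV C (β :: Λ) τ}
    {a : Args FV C Λ Θ} {t' : Tm FV C Θ τ} (h : t.subst (a.lift β) = t'.wk β) :
    ∃ t₀ : Tm FV C Λ τ, t = t₀.wk β ∧ t₀.subst a = t' := by
  -- The two renamings differ at the new variable only.
  let r₁ : Ren (β :: Θ) (β :: β :: Θ) := (Ren.shift β).lift β
  let r₂ : Ren (β :: Θ) (β :: β :: Θ) := Ren.shift β
  have hr : (t.subst (a.lift β)).rename r₁ = (t.subst (a.lift β)).rename r₂ := by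
    rw [h, Tm.wk_eq_rename, Tm.rename_rename, Tm.rename_rename]
    rfl
  rw [Tm.rename_subst, Tm.rename_subst] at hr
  obtain ⟨t₀, rfl⟩ := t.exists_rename_of_subst_eq (Ren.shift β) (fun α x hx => by
    cases x with
    | zero => cases hx
    | succ x => exact ⟨x, rfl⟩) hr
  refine ⟨t₀, rfl, Tm.wk_injective (β := β) ?_⟩
  rw [← Tm.subst_wk]
  exact h

/-- Every solution `v` of the matching problem `v[a'] = a x` is the value under `q` of a variable
whose value under `p` is `x`. -/
def CoversMatchers {Λ Λ' Θ Ω : Ctx B} (a : Args FV C Λ Θ) (a' : Args FV C Λ' Θ)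
    (p : Args FV C Ω Λ) (q : Args FV C Ω Λ') : Prop :=
  ∀ α (x : Var Λ α) (v : Tm FV C Λ' α), v.subst a' = a α x →
    ∃ z, Conv (p α z) (.bvar x) ∧ Conv (q α z) v

theorem CoversMatchers.lift {Λ Λ' Θ Ω : Ctx B} {a : Args FV C Λ Θ} {a' : Args FV C Λ' Θ}
    {p : Args FV C Ω Λ} {q : Args FV C Ω Λ'} (h : CoversMatchers a a' p q) (β : Ty B) :
    CoversMatchers (a.lift β) (a'.lift β) (p.lift β) (q.lift β) := by
  intro α x v hv
  cases x with
  | zero =>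
    refine ⟨.zero, .refl _, ?_⟩
    cases v with
    | bvar y =>
      cases y with
      | zero => exact .refl _
      | succ y =>
        -- A weakened term is not the new variable.
        change (a' _ y).wk _ = .bvar .zero at hv
        generalize a' _ y = s at hv
        cases s <;> cases hv
    | _ => cases hv
  | succ x =>
    obtain ⟨v₀, rfl, hv₀⟩ := Tm.exists_wk_of_subst_lift_eq hv
    obtain ⟨z, hp, hq⟩ := h α x v₀ hv₀
    exact ⟨.succ z, hp.rename (Ren.shift β), hq.rename (Ren.shift β)⟩

/-- Two terms with a common instance are themselves instances, under `p` and `q`, of one term. It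
is built by a simultaneous descent, which stops where one of the two terms is a variable: there
the other one solves a matching problem. -/
theorem exists_common_generalization {Λ Λ' Θ Ω : Ctx B} {τ : Ty B} (t : Tm FV C Λ τ)
    (t' : Tm FV C Λ' τ) {a : Args FV C Λ Θ} {a' : Args FV C Λ' Θ} {p : Args FV C Ω Λ}
    {q : Args FV C Ω Λ'} (h : CoversMatchers a a' p q) (h' : CoversMatchers a' a q p)
    (heq : t.subst a = t'.subst a') :
    ∃ u : Tm FV C Ω τ, Conv (u.subst p) t ∧ Conv (u.subst q) t' := by
  have hvar : ∀ {Λ Λ' Θ Ω : Ctx B} {τ : Ty B} (t : Tm FV C Λ τ) (y : Var Λ' τ)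
      {a : Args FV C Λ Θ} {a' : Args FV C Λ' Θ} {p : Args FV C Ω Λ} {q : Args FV C Ω Λ'},
      CoversMatchers a' a q p → t.subst a = (Tm.bvar y).subst a' →
      ∃ u : Tm FV C Ω τ, Conv (u.subst p) t ∧ Conv (u.subst q) (.bvar y) := by
    intro _ _ _ _ _ t y _ _ _ _ h' heq
    obtain ⟨z, hq, hp⟩ := h' _ y t heq
    exact ⟨.bvar z, hp, hq⟩
  induction t generalizing Λ' Θ Ω with
  | fvar F =>
    cases t' with
    | bvar y => exact hvar _ y h' heq
    | fvar F' => cases heq; exact ⟨.fvar F, .refl _, .refl _⟩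
    | _ => cases heq
  | const c =>
    cases t' with
    | bvar y => exact hvar _ y h' heq
    | const c' => cases heq; exact ⟨.const c, .refl _, .refl _⟩
    | _ => cases heq
  | bvar x =>
    obtain ⟨z, hp, hq⟩ := h _ x t' heq.symm
    exact ⟨.bvar z, hp, hq⟩
  | app s s' ihs ihs' =>
    cases t' with
    | bvar y => exact hvar _ y h' heq
    | app t t' =>
      simp only [Tm.subst, Tm.app.injEq] at heq
      obtain ⟨rfl, heq, heq'⟩ := heq
      obtain ⟨u, hp, hq⟩ := ihs t h h' (eq_of_heq heq)
      obtain ⟨u', hp', hq'⟩ := ihs' t' h h' (eq_of_heq heq')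
      exact ⟨.app u u', .app hp hp', .app hq hq'⟩
    | _ => cases heq
  | lam s ih =>
    cases t' with
    | bvar y => exact hvar _ y h' heq
    | lam t =>
      obtain ⟨u, hp, hq⟩ := ih t (h.lift _) (h'.lift _) (Tm.lam.inj heq)
      exact ⟨.lam u, .lam hp, .lam hq⟩
    | _ => cases heq

/-! ### Finiteness of matching -/

theorem Var.finite (Γ : Ctx B) (α : Ty B) : Finite (Var Γ α) :=
  Finite.of_injective (fun x => (⟨x.level, x.level_lt⟩ : Fin Γ.length)) fun _ _ h =>
    Var.level_injective (Fin.mk.inj h)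

/-- A term is an instance of finitely many terms under a given substitution, because these terms
are obtained from it by putting variables in the place of some subterms. -/
theorem Tm.finite_matchers {Θ : Ctx B} {τ : Ty B} (t : Tm FV C Θ τ) :
    ∀ {Λ : Ctx B} (a : Args FV C Λ Θ), {v : Tm FV C Λ τ | v.subst a = t}.Finite := by
  have hvar : ∀ (Λ : Ctx B) (τ : Ty B),
      (Set.range (Tm.bvar : Var Λ τ → Tm FV C Λ τ)).Finite := fun Λ τ =>
    have := Var.finite Λ τ
    Set.finite_range _
  induction t with
  | fvar F =>
    refine fun {Λ} a => ((hvar Λ _).union (Set.finite_singleton (.fvar F))).subset fun v hv => ?_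
    change v.subst a = _ at hv
    cases v with
    | bvar y => exact .inl ⟨y, rfl⟩
    | fvar F' => cases hv; exact .inr rfl
    | _ => cases hv
  | const c =>
    refine fun {Λ} a => ((hvar Λ _).union (Set.finite_singleton (.const c))).subset fun v hv => ?_
    change v.subst a = _ at hv
    cases v with
    | bvar y => exact .inl ⟨y, rfl⟩
    | const c' => cases hv; exact .inr rfl
    | _ => cases hv
  | bvar x =>
    refine fun {Λ} a => (hvar Λ _).subset fun v hv => ?_
    change v.subst a = _ at hv
    cases v with
    | bvar y => exact ⟨y, rfl⟩
    | _ => cases hv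
  | app s s' ihs ihs' =>
    refine fun {Λ} a => ((hvar Λ _).union
      ((ihs a).image2 Tm.app (ihs' a))).subset fun v hv => ?_
    change v.subst a = _ at hv
    cases v with
    | bvar y => exact .inl ⟨y, rfl⟩
    | app v v' =>
      simp only [Tm.subst, Tm.app.injEq] at hv
      obtain ⟨rfl, hv, hv'⟩ := hv
      exact .inr ⟨v, eq_of_heq hv, v', eq_of_heq hv', rfl⟩
    | _ => cases hv
  | lam s ih =>
    refine fun {Λ} a => ((hvar Λ _).union ((ih (a.lift _)).image Tm.lam)).subset fun v hv => ?_
    change v.subst a = _ at hv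
    cases v with
    | bvar y => exact .inl ⟨y, rfl⟩
    | lam v => exact .inr ⟨v, Tm.lam.inj hv, rfl⟩
    | _ => cases hv

/-! ### Positions in tuples of blocks -/

theorem exists_var_replicate {α : Ty B} {n : ℕ} (j : Fin n) :
    ∃ z : Var (List.replicate n α) α, ∀ {Γ : Ctx B} (a : Fin n → Tm FV C Γ α),
      blockArgs n a α z = a j := by
  induction n with
  | zero => exact j.elim0
  | succ n ih =>
    induction j using Fin.lastCases with
    | last => exact ⟨.zero, fun _ => rfl⟩
    | cast j =>
      obtain ⟨z, hz⟩ := ih j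
      exact ⟨.succ z, fun a => hz fun j => a j.castSucc⟩

theorem exists_eq_of_var_replicate {α β : Ty B} {n : ℕ} (z : Var (List.replicate n α) β) :
    ∃ (h : β = α) (j : Fin n), ∀ {Γ : Ctx B} (a : Fin n → Tm FV C Γ α),
      blockArgs n a β z = h ▸ a j := by
  induction n with
  | zero => exact nomatch z
  | succ n ih =>
    cases z with
    | zero => exact ⟨rfl, Fin.last n, fun _ => rfl⟩
    | succ z =>
      obtain ⟨rfl, j, hj⟩ := ih z
      exact ⟨rfl, j.castSucc, fun a => hj fun j => a j.castSucc⟩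

/-- The position of the `j`-th entry of the block of `i`. -/
theorem exists_var_blockTypes {αs : Ctx B} (k : ∀ α, Var αs α → ℕ) {α : Ty B} (i : Var αs α)
    (j : Fin (k α i)) : ∃ z : Var (blockTypes αs k) α,
      ∀ {Γ : Ctx B} (a : ∀ α (i : Var αs α), Fin (k α i) → Tm FV C Γ α),
        blocksArgs αs k a α z = a α i j := by
  induction i with
  | zero =>
    obtain ⟨z, hz⟩ := exists_var_replicate (FV := FV) (C := C) j
    exact ⟨z.inl, fun a => (Args.append_inl _ _ _).trans (hz _)⟩
  | @succ αs α β i ih =>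
    obtain ⟨z, hz⟩ := ih (fun _ i => k _ (.succ i)) j
    exact ⟨z.inr _, fun a => (Args.append_inr _ _ _).trans (hz fun _ i => a _ (.succ i))⟩

/-- Every position belongs to a block. -/
theorem exists_eq_of_var_blockTypes {αs : Ctx B} (k : ∀ α, Var αs α → ℕ) {α : Ty B}
    (z : Var (blockTypes αs k) α) : ∃ (i : Var αs α) (j : Fin (k α i)),
      ∀ {Γ : Ctx B} (a : ∀ α (i : Var αs α), Fin (k α i) → Tm FV C Γ α),
        blocksArgs αs k a α z = a α i j := by
  induction αs with
  | nil => exact nomatch z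
  | cons β αs ih =>
    obtain ⟨y, rfl⟩ | ⟨y, rfl⟩ := z.inl_or_inr
    · obtain ⟨rfl, j, hj⟩ := exists_eq_of_var_replicate (FV := FV) (C := C) y
      exact ⟨.zero, j, fun a => (Args.append_inl _ _ _).trans (hj _)⟩
    · obtain ⟨i, j, hj⟩ := ih (fun _ i => k _ (.succ i)) y
      exact ⟨.succ i, j, fun a => (Args.append_inr _ _ _).trans (hj fun _ i => a _ (.succ i))⟩

/-! ### Unifiers of solid flexible terms and of the matching problems -/

/-- The long normal form of the body of an abstraction. -/
theorem exists_longNormal_body {Γ αs : Ctx B} {τ : Ty B} (f : Tm FV C Γ (arrows αs τ)) :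
    ∃ t : Tm FV C (αs ++ Γ) τ, LongNormal t ∧ ∀ φ ρ ξ,
      t.den φ (ξ.append ρ) = Den.apps αs (f.den φ ρ) ξ := by
  obtain ⟨t, ht, h⟩ := exists_longNormal (body αs f)
  exact ⟨t, ht, fun φ ρ ξ => by rw [← h.den_eq, den_body]⟩

theorem isUnifier_iff_den {Γ Δ : Ctx B} {τ : Ty B} {s t : Tm FV C Γ (arrows Δ τ)}
    {σ : FSubst FV C Γ} : IsUnifier s t σ ↔ ∀ φ ρ δ,
      Den.apps Δ (s.den (σ.den φ ρ) ρ) δ = Den.apps Δ (t.den (σ.den φ ρ) ρ) δ := by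
  simp only [IsUnifier, conv_lams_iff, Tm.den_fsubst]

theorem isUnifier_flex_flex {Γ Δ αs αs' : Ctx B} {β : Ty B} {F : FV (arrows αs β)}
    {F' : FV (arrows αs' β)} {s n : Args FV C αs (Δ ++ Γ)} {s' n' : Args FV C αs' (Δ ++ Γ)}
    (h : NeutralForms s n) (h' : NeutralForms s' n') {σ : FSubst FV C Γ} :
    IsUnifier (flexTerm Δ F s) (flexTerm Δ F' s') σ ↔ ∀ φ ρ δ,
      Den.apps αs ((σ (fv F)).den φ ρ) (s.den φ (Env.append δ ρ)) =
        Den.apps αs' ((σ (fv F')).den φ ρ) (s'.den φ (Env.append δ ρ)) := by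
  rw [isUnifier_iff_den]
  simp only [den_flexTerm]
  refine forall_congr' fun φ => forall_congr' fun ρ => forall_congr' fun δ => ?_
  rw [h.den_eq _ φ, h'.den_eq _ φ]
  rfl

theorem isUnifier_matching {Γ Δ αs' : Ctx B} {α : Ty B} {t : Tm FV C (Δ ++ Γ) α}
    (ht : t.Ground) {H : FV (arrows αs' α)} {s' n' : Args FV C αs' (Δ ++ Γ)}
    (h' : NeutralForms s' n') {σ : FSubst FV C Γ} :
    IsUnifier (lams Δ t) (flexTerm Δ H s') σ ↔ ∀ φ ρ δ,
      t.den φ (Env.append δ ρ) =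
        Den.apps αs' ((σ (fv H)).den φ ρ) (s'.den φ (Env.append δ ρ)) := by
  rw [isUnifier_iff_den]
  simp only [den_flexTerm, den_lams]
  refine forall_congr' fun φ => forall_congr' fun ρ => forall_congr' fun δ => ?_
  rw [h'.den_eq _ φ, ht.den_eq _ φ]
  rfl

theorem eq_of_den_append_eq {Γ Δ : Ctx B} {τ : Ty B} {s t : Tm FV C (Δ ++ Γ) τ}
    (hs : LongNormal s) (ht : LongNormal t)
    (h : ∀ φ ρ δ, s.den φ (Env.append δ ρ) = t.den φ (Env.append δ ρ)) : s = t := by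
  refine hs.eq_of_den_eq ht fun φ ρ => ?_
  obtain ⟨δ, ρ, rfl⟩ := ρ.exists_append
  exact h φ ρ δ

/-- The substitutions that map `H` to a solution of the matching problem are unifiers. -/
theorem isUnifier_bind_lams {Γ Δ αs' : Ctx B} {α : Ty B} {t : Tm FV C (Δ ++ Γ) α}
    (ht : t.Ground) (H : FV (arrows αs' α)) {s' n' : Args FV C αs' (Δ ++ Γ)}
    (h' : NeutralForms s' n') {v : Tm FV C (αs' ++ Γ) α} (hv : Conv (v.subst n'.over) t) :
    IsUnifier (lams Δ t) (flexTerm Δ H s') ((FSubst.id FV C Γ).bind H (lams αs' v)) := by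
  rw [isUnifier_matching ht h']
  intro φ ρ δ
  rw [FSubst.bind_self, den_lams, ← h'.den_subst_over, hv.den_eq]

/-- Conversely, the value of `H` under a unifier is a solution of the matching problem; as it is
long normal and ground arguments are substituted into it, it is ground. -/
theorem exists_matcher_of_isUnifier {Γ Δ αs' : Ctx B} {α : Ty B} {t : Tm FV C (Δ ++ Γ) α}
    (ht : t.Ground) (htn : LongNormal t) {H : FV (arrows αs' α)}
    {s' n' : Args FV C αs' (Δ ++ Γ)} (h' : NeutralForms s' n') {σ : FSubst FV C Γ}
    (hσ : IsUnifier (lams Δ t) (flexTerm Δ H s') σ) :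
    ∃ v : Tm FV C (αs' ++ Γ) α, v.subst n'.over = t ∧ v.Ground ∧ ∀ φ ρ ξ,
      v.den φ (Env.append ξ ρ) = Den.apps αs' ((σ (fv H)).den φ ρ) ξ := by
  obtain ⟨v, hvn, hv⟩ := exists_longNormal_body (σ (fv H))
  have hvt : v.subst n'.over = t := by
    refine eq_of_den_append_eq ((v.normal_subst _ h'.neutral_over).2 hvn) htn fun φ ρ δ => ?_
    rw [h'.den_subst_over, hv, (isUnifier_matching ht h').1 hσ]
  refine ⟨v, hvt, Tm.Ground.of_subst (s := n'.over) ?_, hv⟩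
  rw [hvt]
  exact ht

/-- The unifiers of the matching problem that come from the finitely many solutions form a complete
set. As the solutions are ground, it needs no auxiliary variables. -/
theorem exists_finite_csu {Γ Δ αs' : Ctx B} {α : Ty B} {t : Tm FV C (Δ ++ Γ) α}
    (ht : t.Ground) (htn : LongNormal t) (H : FV (arrows αs' α))
    {s' n' : Args FV C αs' (Δ ++ Γ)} (h' : NeutralForms s' n') :
    ∃ (k : ℕ) (csu : Fin k → FSubst FV C Γ),
      IsCSU (lams Δ t) (flexTerm Δ H s') (Set.range csu) ∅ := by
  obtain ⟨k, f, -, hf⟩ := (t.finite_matchers n'.over).fin_param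
  refine ⟨k, fun j => (FSubst.id FV C Γ).bind H (lams αs' (f j)), ?_, fun X hX => hX.elim, ?_⟩
  · rintro _ ⟨j, rfl⟩
    have hj : f j ∈ Set.range f := ⟨j, rfl⟩
    rw [hf] at hj
    exact isUnifier_bind_lams ht H h' (hj ▸ .refl _)
  · intro τ hτ
    obtain ⟨v, hvt, hvg, hv⟩ := exists_matcher_of_isUnifier ht htn h' hτ
    obtain ⟨j, rfl⟩ : v ∈ Set.range f := hf ▸ hvt
    refine ⟨(FSubst.id FV C Γ).bind H (lams αs' (f j)), ⟨j, rfl⟩, τ,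
      fun X _ => conv_iff_den.2 fun φ ρ => ?_⟩
    rw [Tm.den_fsubst]
    by_cases hX : X = fv H
    · subst hX
      refine Den.apps_injective fun ξ => ?_
      rw [FSubst.bind_self, den_lams, hvg.den_eq _ φ, hv]
    · rw [FSubst.bind_of_ne _ _ hX]
      rfl

theorem MatchingCSUs.den_sol {Γ Δ αs αs' : Ctx B} {s : Args FV C αs (Δ ++ Γ)}
    {s' : Args FV C αs' (Δ ++ Γ)} (M : MatchingCSUs Γ Δ s s') {α : Ty B} (i : Var αs α)
    (j : Fin (M.num α i)) (φ : Valuation FV C) (ξ : Env FV C αs') (ρ : Env FV C Γ) :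
    (M.sol α i j).den φ (ξ.append ρ) =
      Den.apps αs' ((M.csu α i j (fv (M.H α i))).den φ ρ) ξ :=
  den_body φ αs' _ ξ ρ

/-- The values `s_i^j` do not depend on free variables. -/
theorem MatchingCSUs.den_sol_eq {Γ Δ αs αs' : Ctx B} {s n : Args FV C αs (Δ ++ Γ)}
    {s' n' : Args FV C αs' (Δ ++ Γ)} (M : MatchingCSUs Γ Δ s s') (h : NeutralForms s n)
    (h' : NeutralForms s' n') {α : Ty B} (i : Var αs α) (j : Fin (M.num α i))
    (φ φ' : Valuation FV C) (ξ : Env FV C αs') (ρ : Env FV C Γ) :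
    (M.sol α i j).den φ (ξ.append ρ) = (M.sol α i j).den φ' (ξ.append ρ) := by
  obtain ⟨v, -, hvg, hv⟩ := exists_matcher_of_isUnifier (h.ground α i) (h.longNormal α i) h'
    ((M.isCSU α i).1 _ ⟨j, rfl⟩)
  rw [M.den_sol, M.den_sol, ← hv, ← hv, hvg.den_eq]

/-- `s_i^j` is a solution of the matching problem for `s_i`. -/
theorem MatchingCSUs.den_sol_args {Γ Δ αs αs' : Ctx B} {s n : Args FV C αs (Δ ++ Γ)}
    {s' n' : Args FV C αs' (Δ ++ Γ)} (M : MatchingCSUs Γ Δ s s') (h : NeutralForms s n)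
    (h' : NeutralForms s' n') {α : Ty B} (i : Var αs α) (j : Fin (M.num α i))
    (φ : Valuation FV C) (δ : Env FV C Δ) (ρ : Env FV C Γ) :
    (M.sol α i j).den φ ((s'.den φ (δ.append ρ)).append ρ) =
      (s α i).den φ (δ.append ρ) := by
  rw [M.den_sol, (isUnifier_matching (h.ground α i) h').1 ((M.isCSU α i).1 _ ⟨j, rfl⟩)]

theorem occurs_flexTerm {Γ Δ αs : Ctx B} {β : Ty B} (F : FV (arrows αs β))
    (s : Args FV C αs (Δ ++ Γ)) : (flexTerm Δ F s).Occurs (fv F) := by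
  have happs : ∀ {Γ : Ctx B} (αs : Ctx B) {τ : Ty B} (f : Tm FV C Γ (arrows αs τ))
      (s : Args FV C αs Γ), f.Occurs (fv F) → (apps αs f s).Occurs (fv F) := by
    intro Γ αs
    induction αs with
    | nil => exact fun _ _ h => h
    | cons α αs ih => exact fun {τ} f s h => .inl (ih (τ := .arr α τ) f _ h)
  have hlams : ∀ (Δ : Ctx B) {τ : Ty B} (t : Tm FV C (Δ ++ Γ) τ), t.Occurs (fv F) →
      (lams Δ t).Occurs (fv F) := by
    intro Δ
    induction Δ with
    | nil => exact fun _ h => h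
    | cons α Δ ih => exact fun t h => ih (.lam t) h
  exact hlams Δ _ (happs αs _ s rfl)

/-- Every solution of the matching problem for `s_i` is one of the `s_i^j`. -/
theorem MatchingCSUs.exists_conv_sol {Γ Δ αs αs' : Ctx B} {s n : Args FV C αs (Δ ++ Γ)}
    {s' n' : Args FV C αs' (Δ ++ Γ)} (M : MatchingCSUs Γ Δ s s') (h : NeutralForms s n)
    (h' : NeutralForms s' n') {α : Ty B} (i : Var αs α) {v : Tm FV C (αs' ++ Γ) α}
    (hv : v.subst n'.over = n α i) : ∃ j, Conv (M.sol α i j) v := by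
  have hunif := isUnifier_bind_lams (h.ground α i) (M.H α i) h' (v := v)
    (hv ▸ (h.conv α i).symm)
  obtain ⟨-, haux, hcomplete⟩ := M.isCSU α i
  obtain ⟨_, ⟨j, rfl⟩, θ, hθ⟩ := hcomplete _ hunif
  -- Auxiliary variables do not occur in the problem, whereas `H i` does.
  have hH : fv (M.H α i) ∉ M.aux α i := fun hX => (haux _ hX).2 (occurs_flexTerm _ _)
  refine ⟨j, conv_iff_den.2 fun φ ρ => ?_⟩
  obtain ⟨ξ, ρ, rfl⟩ := ρ.exists_append
  rw [M.den_sol_eq h h' i j φ (θ.den φ ρ), M.den_sol, ← Tm.den_fsubst, ← (hθ _ hH).den_eq,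
    FSubst.bind_self, den_lams]

/-! ### Fresh heads -/

theorem exists_fvar_notMem [∀ τ, Infinite (FV τ)] (τ : Ty B) {S : Set (FVar FV)}
    (hS : S.Finite) : ∃ X : FV τ, fv X ∉ S := by
  obtain ⟨_, ⟨X, rfl⟩, hX⟩ :=
    (Set.infinite_range_of_injective
      (sigma_mk_injective (β := FV) (i := τ))).exists_notMem_finite hS
  exact ⟨X, hX⟩

/-- The value of `f` can be written with a new head `Z` if its body is an instance `u[p]` and the
arguments `p` do not depend on free variables. -/
theorem conv_lams_apps_fsubst {Γ αs ct : Ctx B} {β : Ty B} (Z : FV (arrows ct β))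
    {p : Args FV C ct (αs ++ Γ)}
    (hp : ∀ φ φ' ξ ρ, p.den φ (Env.append ξ ρ) = p.den φ' (Env.append ξ ρ))
    {f : Tm FV C Γ (arrows αs β)} {t : Tm FV C (αs ++ Γ) β}
    (ht : ∀ φ ρ ξ, t.den φ (Env.append ξ ρ) = Den.apps αs (f.den φ ρ) ξ)
    {u : Tm FV C (ct ++ Γ) β} (hu : Conv (u.subst p.over) t) (τ : FSubst FV C Γ) :
    Conv f ((lams αs (apps ct (.fvar Z) p)).fsubst (τ.bind Z (lams ct u))) := by
  rw [conv_lams_iff]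
  intro φ ρ ξ
  rw [Tm.den_fsubst, den_lams, den_apps, Tm.den, FSubst.den, FSubst.bind_self, den_lams,
    hp _ φ, ← ht, ← hu.den_eq, Tm.den_subst', Args.den_over]

/-! ### Equal heads -/

theorem Tm.subst_eq_rename {Γ Δ : Ctx B} {τ : Ty B} (t : Tm FV C Γ τ) {s : Args FV C Γ Δ}
    {r : Ren Γ Δ} (h : ∀ α x, s α x = .bvar (r α x)) : t.subst s = t.rename r := by
  rw [← Tm.subst_id (t.rename r), Tm.subst_rename]
  congr 1
  exact funext fun α => funext fun x => h α x

/-- The arguments `x_{j_1}, …, x_{j_r}`. -/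
noncomputable abbrev agreeArgs {Γ Δ αs : Ctx B} (s s' : Args FV C αs (Δ ++ Γ)) :
    Args FV C (blockTypes αs (agree s s')) (αs ++ Γ) :=
  blocksArgs αs (agree s s') fun α i _ => boundVars FV C Γ αs α i

theorem agreeArgs_eq_boundVars {Γ Δ αs : Ctx B} (s s' : Args FV C αs (Δ ++ Γ)) {α : Ty B}
    (z : Var (blockTypes αs (agree s s')) α) :
    ∃ i : Var αs α, Conv (s α i) (s' α i) ∧ agreeArgs s s' α z = .bvar i.inl := by
  obtain ⟨i, j, h⟩ := exists_eq_of_var_blockTypes (FV := FV) (C := C) (agree s s') z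
  refine ⟨i, ?_, h _⟩
  by_contra hn
  have h0 : agree s s' α i = 0 := if_neg hn
  exact (Fin.cast h0 j).elim0

theorem exists_agreeArgs_eq_boundVars {Γ Δ αs : Ctx B} (s s' : Args FV C αs (Δ ++ Γ)) {α : Ty B}
    (i : Var αs α) (h : Conv (s α i) (s' α i)) : ∃ z, agreeArgs s s' α z = .bvar i.inl := by
  have hj : 0 < agree s s' α i := by
    rw [agree, if_pos h]
    exact Nat.one_pos
  obtain ⟨z, hz⟩ := exists_var_blockTypes (FV := FV) (C := C) (agree s s') i ⟨0, hj⟩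
  exact ⟨z, hz _⟩

theorem den_agreeArgs {Γ Δ αs : Ctx B} (s s' : Args FV C αs (Δ ++ Γ)) (φ φ' : Valuation FV C)
    {ξ ξ' : Env FV C αs} (ρ : Env FV C Γ)
    (h : ∀ α i, Conv (s α i) (s' α i) → ξ α i = ξ' α i) :
    (agreeArgs s s').den φ (ξ.append ρ) = (agreeArgs s s').den φ' (ξ'.append ρ) := by
  funext α z
  obtain ⟨i, hi, hz⟩ := agreeArgs_eq_boundVars s s' z
  rw [Args.den, Args.den, hz, Tm.den, Tm.den, Env.append_inl, Env.append_inl, h α i hi]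

theorem isMGU_eliminationSubst {Γ Δ αs : Ctx B} {b : B} {F : FV (arrows αs (.base b))}
    {s s' n n' : Args FV C αs (Δ ++ Γ)} (h : NeutralForms s n) (h' : NeutralForms s' n')
    (G : FV (arrows (blockTypes αs (agree s s')) (.base b))) (hG : fv G ≠ fv F) :
    IsMGU (flexTerm Δ F s) (flexTerm Δ F s') (eliminationSubst F s s' G) {fv G} := by
  refine ⟨?_, ?_, fun τ hτ => ⟨_, rfl, ?_⟩⟩
  · rintro _ rfl
    rw [isUnifier_flex_flex h h']
    intro φ ρ δ
    rw [eliminationSubst, FSubst.bind_self, den_lams, den_lams, den_apps, den_apps, Tm.den,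
      Tm.den]
    exact congrArg _ (den_agreeArgs s s' φ φ ρ fun α i hi => hi.den_eq _ _)
  · rintro _ rfl
    exact ⟨fun hX => hG (eq_of_occurs_flexTerm h.ground hX),
      fun hX => hG (eq_of_occurs_flexTerm h'.ground hX)⟩
  · obtain ⟨t, htn, ht⟩ := exists_longNormal_body (τ (fv F))
    have heq : t.subst n.over = t.subst n'.over := by
      refine eq_of_den_append_eq ((t.normal_subst _ h.neutral_over).2 htn)
        ((t.normal_subst _ h'.neutral_over).2 htn) fun φ ρ δ => ?_
      rw [h.den_subst_over, h'.den_subst_over, ht, ht, (isUnifier_flex_flex h h').1 hτ]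
    have hvar : ∀ α z, ∃ x, (agreeArgs s s').over α z = .bvar x := by
      intro α z
      obtain ⟨z, rfl⟩ | ⟨z, rfl⟩ := z.inl_or_inr
      · obtain ⟨i, -, hi⟩ := agreeArgs_eq_boundVars s s' z
        exact ⟨_, (Args.over_inl _ _).trans hi⟩
      · exact ⟨_, Args.over_inr _ _⟩
    choose r hr using hvar
    obtain ⟨u, hu⟩ := t.exists_rename_of_subst_eq r (fun α x hx => by
      obtain ⟨i, rfl⟩ | ⟨x, rfl⟩ := x.inl_or_inr
      · rw [Args.over_inl, Args.over_inl] at hx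
        have hi : Conv (s α i) (s' α i) := (h.conv α i).trans (hx ▸ (h'.conv α i).symm)
        obtain ⟨z, hz⟩ := exists_agreeArgs_eq_boundVars s s' i hi
        exact ⟨z.inl, Tm.bvar.inj ((hr _ _).symm.trans ((Args.over_inl _ _).trans hz))⟩
      · exact ⟨x.inr _, Tm.bvar.inj ((hr _ _).symm.trans (Args.over_inr _ _))⟩) heq
    rw [← Tm.subst_eq_rename u hr] at hu
    refine ⟨τ.bind G (lams _ u), fun X hX => ?_⟩
    by_cases hXF : X = fv F
    · subst hXF
      rw [eliminationSubst, FSubst.bind_self]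
      exact conv_lams_apps_fsubst G (fun φ φ' ξ ρ => den_agreeArgs s s' φ φ' ρ fun _ _ _ => rfl)
        ht (hu ▸ .refl _) τ
    · rw [eliminationSubst, FSubst.bind_of_ne _ _ hXF]
      change Conv _ ((τ.bind G _) X)
      rw [FSubst.bind_of_ne _ _ hX]
      exact .refl _

/-! ### Different heads -/

theorem Var.inr_injective {Γ : Ctx B} (Δ : Ctx B) {α : Ty B} {x y : Var Γ α}
    (h : x.inr Δ = y.inr Δ) : x = y := by
  induction Δ with
  | nil => exact h
  | cons β Δ ih => exact ih (Var.succ.inj h)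

/-- For the matching problems `v[n'] = γ` with a variable `γ` of the common context `Γ`, either `v`
is `γ`, or `v` is an argument variable for which `γ` is a solution of the opposite matching
problem. Hence it suffices to consider the matching problems for the arguments. -/
theorem coversMatchers_over {Γ Δ αs αs' ct : Ctx B} {n : Args FV C αs (Δ ++ Γ)}
    {n' : Args FV C αs' (Δ ++ Γ)} {p : Args FV C ct (αs ++ Γ)} {q : Args FV C ct (αs' ++ Γ)}
    (hl : ∀ α (i : Var αs α) (v : Tm FV C (αs' ++ Γ) α), v.subst n'.over = n α i →
      ∃ z, p α z = .bvar i.inl ∧ Conv (q α z) v)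
    (hr : ∀ α (i : Var αs' α) (v : Tm FV C (αs ++ Γ) α), v.subst n.over = n' α i →
      ∃ z, q α z = .bvar i.inl ∧ Conv (p α z) v) :
    CoversMatchers n.over n'.over p.over q.over := by
  intro α x v hv
  obtain ⟨i, rfl⟩ | ⟨x, rfl⟩ := x.inl_or_inr
  · rw [Args.over_inl] at hv
    obtain ⟨z, hp, hq⟩ := hl α i v hv
    refine ⟨z.inl, ?_, ?_⟩
    · rw [Args.over_inl, hp]
      exact .refl _
    · rwa [Args.over_inl]
  · rw [Args.over_inr] at hv
    cases v with
    | bvar y =>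
      obtain ⟨k, rfl⟩ | ⟨y, rfl⟩ := y.inl_or_inr
      · rw [Tm.subst, Args.over_inl] at hv
        obtain ⟨z, hq, hp⟩ := hr α k (.bvar (x.inr αs)) ((Args.over_inr n x).trans hv.symm)
        refine ⟨z.inl, ?_, ?_⟩
        · rwa [Args.over_inl]
        · rw [Args.over_inl, hq]
          exact .refl _
      · rw [Tm.subst, Args.over_inr] at hv
        obtain rfl := Var.inr_injective Δ (Tm.bvar.inj hv)
        refine ⟨y.inr ct, ?_, ?_⟩ <;> rw [Args.over_inr] <;> exact .refl _
    | _ => cases hv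

section

variable {Γ Δ αs αs' : Ctx B} {s n : Args FV C αs (Δ ++ Γ)} {s' n' : Args FV C αs' (Δ ++ Γ)}

/-- The arguments of `Z` in the value of `F`. -/
abbrev leftArgs (M : MatchingCSUs Γ Δ s s') (M' : MatchingCSUs Γ Δ s' s) :
    Args FV C (commonTypes M M') (αs ++ Γ) :=
  (blocksArgs αs M.num fun α i _ => boundVars FV C Γ αs α i).append
    (blockTypes αs' M'.num) (blocksArgs αs' M'.num M'.sol)

/-- The arguments of `Z` in the value of `F'`. -/
abbrev rightArgs (M : MatchingCSUs Γ Δ s s') (M' : MatchingCSUs Γ Δ s' s) :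
    Args FV C (commonTypes M M') (αs' ++ Γ) :=
  (blocksArgs αs M.num M.sol).append
    (blockTypes αs' M'.num) (blocksArgs αs' M'.num fun α i _ => boundVars FV C Γ αs' α i)

theorem exists_position_of_sol (M : MatchingCSUs Γ Δ s s') (M' : MatchingCSUs Γ Δ s' s)
    {α : Ty B} (i : Var αs α) (j : Fin (M.num α i)) :
    ∃ z, leftArgs M M' α z = .bvar i.inl ∧ rightArgs M M' α z = M.sol α i j := by
  obtain ⟨z, hz⟩ := exists_var_blockTypes (FV := FV) (C := C) M.num i j
  exact ⟨z.inr _, (Args.append_inr _ _ _).trans (hz _), (Args.append_inr _ _ _).trans (hz _)⟩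

theorem exists_position_of_sol' (M : MatchingCSUs Γ Δ s s') (M' : MatchingCSUs Γ Δ s' s)
    {α : Ty B} (i : Var αs' α) (j : Fin (M'.num α i)) :
    ∃ z, leftArgs M M' α z = M'.sol α i j ∧ rightArgs M M' α z = .bvar i.inl := by
  obtain ⟨z, hz⟩ := exists_var_blockTypes (FV := FV) (C := C) M'.num i j
  exact ⟨z.inl, (Args.append_inl _ _ _).trans (hz _), (Args.append_inl _ _ _).trans (hz _)⟩

theorem leftArgs_rightArgs_cases (M : MatchingCSUs Γ Δ s s') (M' : MatchingCSUs Γ Δ s' s)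
    {α : Ty B} (z : Var (commonTypes M M') α) :
    (∃ i j, leftArgs M M' α z = .bvar (Var.inl i) ∧ rightArgs M M' α z = M.sol α i j) ∨
      ∃ i j, leftArgs M M' α z = M'.sol α i j ∧ rightArgs M M' α z = .bvar (Var.inl i) := by
  obtain ⟨y, rfl⟩ | ⟨y, rfl⟩ := z.inl_or_inr
  · obtain ⟨i, j, h⟩ := exists_eq_of_var_blockTypes (FV := FV) (C := C) M'.num y
    exact .inr ⟨i, j, (Args.append_inl _ _ _).trans (h _), (Args.append_inl _ _ _).trans (h _)⟩
  · obtain ⟨i, j, h⟩ := exists_eq_of_var_blockTypes (FV := FV) (C := C) M.num y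
    exact .inl ⟨i, j, (Args.append_inr _ _ _).trans (h _), (Args.append_inr _ _ _).trans (h _)⟩

theorem den_leftArgs_eq (h : NeutralForms s n) (h' : NeutralForms s' n')
    (M : MatchingCSUs Γ Δ s s') (M' : MatchingCSUs Γ Δ s' s) (φ φ' : Valuation FV C)
    (ξ : Env FV C αs) (ρ : Env FV C Γ) :
    (leftArgs M M').den φ (ξ.append ρ) = (leftArgs M M').den φ' (ξ.append ρ) := by
  funext α z
  obtain ⟨i, j, hz, -⟩ | ⟨i, j, hz, -⟩ := leftArgs_rightArgs_cases M M' z <;>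
    rw [Args.den, Args.den, hz]
  · rfl
  · exact M'.den_sol_eq h' h i j φ φ' ξ ρ

theorem den_rightArgs_eq (h : NeutralForms s n) (h' : NeutralForms s' n')
    (M : MatchingCSUs Γ Δ s s') (M' : MatchingCSUs Γ Δ s' s) (φ φ' : Valuation FV C)
    (ξ : Env FV C αs') (ρ : Env FV C Γ) :
    (rightArgs M M').den φ (ξ.append ρ) = (rightArgs M M').den φ' (ξ.append ρ) := by
  funext α z
  obtain ⟨i, j, -, hz⟩ | ⟨i, j, -, hz⟩ := leftArgs_rightArgs_cases M M' z <;>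
    rw [Args.den, Args.den, hz]
  · exact M.den_sol_eq h h' i j φ φ' ξ ρ
  · rfl

theorem den_leftArgs_eq_den_rightArgs (h : NeutralForms s n) (h' : NeutralForms s' n')
    (M : MatchingCSUs Γ Δ s s') (M' : MatchingCSUs Γ Δ s' s) (φ : Valuation FV C)
    (δ : Env FV C Δ) (ρ : Env FV C Γ) :
    (leftArgs M M').den φ ((s.den φ (δ.append ρ)).append ρ) =
      (rightArgs M M').den φ ((s'.den φ (δ.append ρ)).append ρ) := by
  funext α z
  obtain ⟨i, j, hz, hz'⟩ | ⟨i, j, hz, hz'⟩ := leftArgs_rightArgs_cases M M' z <;>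
    rw [Args.den, Args.den, hz, hz', Tm.den, Env.append_inl]
  · exact (M.den_sol_args h h' i j φ δ ρ).symm
  · exact M'.den_sol_args h' h i j φ δ ρ

theorem isMGU_commonHeadSubst {b : B} {F : FV (arrows αs (.base b))}
    {F' : FV (arrows αs' (.base b))} (hF : fv F ≠ fv F') (h : NeutralForms s n)
    (h' : NeutralForms s' n') (M : MatchingCSUs Γ Δ s s') (M' : MatchingCSUs Γ Δ s' s)
    (Z : FV (arrows (commonTypes M M') (.base b))) (hFV : fv F ∉ M.vars ∪ M'.vars ∪ {fv Z})
    (hFV' : fv F' ∉ M.vars ∪ M'.vars ∪ {fv Z}) :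
    IsMGU (flexTerm Δ F s) (flexTerm Δ F' s') (commonHeadSubst F F' M M' Z)
      (M.vars ∪ M'.vars ∪ {fv Z}) := by
  have hσ : commonHeadSubst F F' M M' Z (fv F) =
      lams αs (apps (commonTypes M M') (.fvar Z) (leftArgs M M')) := by
    rw [commonHeadSubst, FSubst.bind_of_ne _ _ hF, FSubst.bind_self]
  have hσ' : commonHeadSubst F F' M M' Z (fv F') =
      lams αs' (apps (commonTypes M M') (.fvar Z) (rightArgs M M')) := by
    rw [commonHeadSubst, FSubst.bind_self]
  refine ⟨?_, fun X hX => ⟨fun hX' => hFV (eq_of_occurs_flexTerm h.ground hX' ▸ hX),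
    fun hX' => hFV' (eq_of_occurs_flexTerm h'.ground hX' ▸ hX)⟩, fun τ hτ => ⟨_, rfl, ?_⟩⟩
  · rintro _ rfl
    rw [isUnifier_flex_flex h h']
    intro φ ρ δ
    rw [hσ, hσ', den_lams, den_lams, den_apps, den_apps, Tm.den, Tm.den,
      den_leftArgs_eq_den_rightArgs h h']
  · obtain ⟨t, htn, ht⟩ := exists_longNormal_body (τ (fv F))
    obtain ⟨t', htn', ht'⟩ := exists_longNormal_body (τ (fv F'))
    have heq : t.subst n.over = t'.subst n'.over := by
      refine eq_of_den_append_eq ((t.normal_subst _ h.neutral_over).2 htn)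
        ((t'.normal_subst _ h'.neutral_over).2 htn') fun φ ρ δ => ?_
      rw [h.den_subst_over, h'.den_subst_over, ht, ht', (isUnifier_flex_flex h h').1 hτ]
    have hl : ∀ α (i : Var αs α) (v : Tm FV C (αs' ++ Γ) α), v.subst n'.over = n α i →
        ∃ z, leftArgs M M' α z = .bvar i.inl ∧ Conv (rightArgs M M' α z) v := by
      intro α i v hv
      obtain ⟨j, hj⟩ := M.exists_conv_sol h h' i hv
      obtain ⟨z, hz, hz'⟩ := exists_position_of_sol M M' i j
      exact ⟨z, hz, hz' ▸ hj⟩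
    have hr : ∀ α (i : Var αs' α) (v : Tm FV C (αs ++ Γ) α), v.subst n.over = n' α i →
        ∃ z, rightArgs M M' α z = .bvar i.inl ∧ Conv (leftArgs M M' α z) v := by
      intro α i v hv
      obtain ⟨j, hj⟩ := M'.exists_conv_sol h' h i hv
      obtain ⟨z, hz, hz'⟩ := exists_position_of_sol' M M' i j
      exact ⟨z, hz', hz ▸ hj⟩
    obtain ⟨u, hu, hu'⟩ := exists_common_generalization t t' (coversMatchers_over hl hr)
      (coversMatchers_over hr hl) heq
    refine ⟨τ.bind Z (lams _ u), fun X hX => ?_⟩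
    by_cases hXF : X = fv F
    · subst hXF
      rw [hσ]
      exact conv_lams_apps_fsubst Z (den_leftArgs_eq h h' M M') ht hu τ
    by_cases hXF' : X = fv F'
    · subst hXF'
      rw [hσ']
      exact conv_lams_apps_fsubst Z (den_rightArgs_eq h h' M M') ht' hu' τ
    · rw [commonHeadSubst, FSubst.bind_of_ne _ _ hXF', FSubst.bind_of_ne _ _ hXF]
      change Conv _ ((τ.bind Z _) X)
      rw [FSubst.bind_of_ne _ _ fun hXZ => hX (.inr hXZ)]
      exact .refl _

theorem exists_matchingCSUs (h : NeutralForms s n) (h' : NeutralForms s' n')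
    (H : ∀ α, Var αs α → FV (arrows αs' α)) :
    ∃ M : MatchingCSUs Γ Δ s s', M.H = H ∧ ∀ α i, M.aux α i = ∅ := by
  choose k csu hcsu using fun α i =>
    exists_finite_csu (h.ground α i) (h.longNormal α i) (H α i) h'
  exact ⟨⟨H, k, csu, fun _ _ => ∅, hcsu⟩, rfl, fun _ _ => rfl⟩

theorem exists_matchingCSUs_notMem_vars [∀ τ, Infinite (FV τ)] (h : NeutralForms s n)
    (h' : NeutralForms s' n') {S : Set (FVar FV)} (hS : S.Finite) :
    ∃ M : MatchingCSUs Γ Δ s s', ∀ X ∈ S, X ∉ M.vars := by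
  choose H hH using fun (α : Ty B) (_ : Var αs α) => exists_fvar_notMem (arrows αs' α) hS
  obtain ⟨M, rfl, haux⟩ := exists_matchingCSUs h h' H
  refine ⟨M, ?_⟩
  rintro X hX ⟨α, i, rfl | hi⟩
  · exact hH α i hX
  · rw [haux] at hi
    exact hi

end

end

end HOU

theorem lemma5p6 {B : Type*} {FV C : Ty B → Type*} [∀ τ, Infinite (FV τ)] (Γ Δ : Ctx B) (b : B) :
    -- different heads
    (∀ (αs αs' : Ctx B) (F : FV (arrows αs (Ty.base b))) (F' : FV (arrows αs' (Ty.base b)))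
      (s : Args FV C αs (Δ ++ Γ)) (s' : Args FV C αs' (Δ ++ Γ)),
      fv F ≠ fv F' → (flexTerm Δ F s).Solid → (flexTerm Δ F' s').Solid →
      -- the matching problems have finite complete sets of unifiers, for any choice of the `H i`
      (∀ H, ∃ M : MatchingCSUs Γ Δ s s', M.H = H ∧ ∀ α i, fv F ∉ M.aux α i ∧ fv F' ∉ M.aux α i) ∧
      (∀ H, ∃ M' : MatchingCSUs Γ Δ s' s, M'.H = H ∧
        ∀ α i, fv F ∉ M'.aux α i ∧ fv F' ∉ M'.aux α i) ∧
      -- fresh choices of all the auxiliary variables are possible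
      (∃ (M : MatchingCSUs Γ Δ s s') (M' : MatchingCSUs Γ Δ s' s)
        (Z : FV (arrows (commonTypes M M') (Ty.base b))),
        fv F ∉ M.vars ∪ M'.vars ∪ {fv Z} ∧ fv F' ∉ M.vars ∪ M'.vars ∪ {fv Z}) ∧
      -- any fresh choice yields a most general unifier
      (∀ (M : MatchingCSUs Γ Δ s s') (M' : MatchingCSUs Γ Δ s' s)
        (Z : FV (arrows (commonTypes M M') (Ty.base b))),
        fv F ∉ M.vars ∪ M'.vars ∪ {fv Z} → fv F' ∉ M.vars ∪ M'.vars ∪ {fv Z} →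
        IsMGU (flexTerm Δ F s) (flexTerm Δ F' s') (commonHeadSubst F F' M M' Z)
          (M.vars ∪ M'.vars ∪ {fv Z}))) ∧
    -- equal heads
    (∀ (αs : Ctx B) (F : FV (arrows αs (Ty.base b))) (s s' : Args FV C αs (Δ ++ Γ)),
      (flexTerm Δ F s).Solid → (flexTerm Δ F s').Solid →
      (∃ G : FV (arrows (blockTypes αs (agree s s')) (Ty.base b)), fv G ≠ fv F) ∧
      (∀ G : FV (arrows (blockTypes αs (agree s s')) (Ty.base b)), fv G ≠ fv F →
        IsMGU (flexTerm Δ F s) (flexTerm Δ F s') (eliminationSubst F s s' G) {fv G})) := by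
  refine ⟨fun αs αs' F F' s s' hF hs hs' => ?_, fun αs F s s' hs hs' => ?_⟩
  · obtain ⟨n, h⟩ := hs.exists_neutralForms
    obtain ⟨n', h'⟩ := hs'.exists_neutralForms
    refine ⟨fun H => ?_, fun H => ?_, ?_, isMGU_commonHeadSubst hF h h'⟩
    · obtain ⟨M, hM, haux⟩ := exists_matchingCSUs h h' H
      refine ⟨M, hM, fun α i => ?_⟩
      rw [haux]
      exact ⟨id, id⟩
    · obtain ⟨M', hM', haux⟩ := exists_matchingCSUs h' h H
      refine ⟨M', hM', fun α i => ?_⟩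
      rw [haux]
      exact ⟨id, id⟩
    · have hfin : ({fv F, fv F'} : Set (FVar FV)).Finite := Set.toFinite _
      obtain ⟨M, hM⟩ := exists_matchingCSUs_notMem_vars h h' hfin
      obtain ⟨M', hM'⟩ := exists_matchingCSUs_notMem_vars h' h hfin
      obtain ⟨Z, hZ⟩ := exists_fvar_notMem (arrows (commonTypes M M') (Ty.base b)) hfin
      refine ⟨M, M', Z, ?_, ?_⟩
      · rintro ((hX | hX) | hX)
        exacts [hM _ (.inl rfl) hX, hM' _ (.inl rfl) hX, hZ (.inl hX.symm)]
      · rintro ((hX | hX) | hX)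
        exacts [hM _ (.inr rfl) hX, hM' _ (.inr rfl) hX, hZ (.inr hX.symm)]
  · obtain ⟨n, h⟩ := hs.exists_neutralForms
    obtain ⟨n', h'⟩ := hs'.exists_neutralForms
    exact ⟨exists_fvar_notMem _ (Set.finite_singleton (fv F)), isMGU_eliminationSubst h h'⟩
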